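/- **Theorem 1.1 (stability of $\lambda_\infty$).** Let $1<p<\infty$ and $d\ge 2$. For an open set $\Omega\subset\mathbb R^m$ put $$\lambda_1(\Omega):=\inf_{0\ne u\in W^{1,p}_0(\Omega)}\frac{\int_\Omega|\nabla u|^p\,dx}{\int_\Omega|u|^p\,dx}\in[0,\infty],\qquad \lambda_\infty(\Omega):=\sup_{K\subset\Omega\ \text{compact}}\lambda_1(\Omega\setminus K)\in[0,\infty],$$ where $W^{1,p}_0(\Omega)$ is the closure of $C_0^\infty(\Omega)$ in $W^{1,p}(\Omega)$. Let $\omega\subset\mathbb R^{d-1}$ be a non-empty bounded connected open set, $a:=\sup_{t\in\omega}|t|$, and let $\phi_1\in W^{1,p}_0(\omega)$ be its first eigenfunction, i.e. the positive minimiser of the quotient defining $\lambda_1(\omega)$ with $\int_\omega|\phi_1|^p\,dt=1$. Let $\Gamma:\mathbb R\to\mathbb R^d$ be a unit-speed curve whose derivative $T:=\Gamma'$ is locally Lipschitz, with curvature $\kappa:=|\Gamma''|$ (defined almost everywhere). Let $N_1,\dots,N_{d-1}:\mathbb R\to\mathbb R^d$ be locally Lipschitz vector fields such that $(T,N_1,\dots,N_{d-1})(s)$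 is orthonormal for every $s$ and, for some functions $\kappa_1,\dots,\kappa_{d-1}:\mathbb R\to\mathbb R$, one has $T'=\sum_j\kappa_jN_j$ and $N_j'=-\kappa_jT$ almost everywhere. Let $R:\mathbb R\to \mathsf{SO}(d-1)$ be locally Lipschitz. Consider the bent twisted tube (summation over repeated Greek indices from $1$ to $d-1$) $$\Omega_{\kappa,R}:=\mathscr L(\mathbb R\times\omega),\qquad \mathscr L(s,t):=\Gamma(s)+t_\mu R_{\mu\nu}(s)N_\nu(s),$$ and assume that it does not overlap itself: $\kappa\in L^\infty(\mathbb R)$, $a\,\|\kappa\|_{L^\infty(\mathbb R)}<1$, and $\mathscr L$ is injective on $\mathbb R\times\omega$. Let $f_\mu(s,t):=t_\alpha R'_{\alpha\beta}(s)R_{\mu\beta}(s)$ and $$r(s):=\int_\omega|f_\mu(s,t)\,\partial_{t_\mu}\phi_1(t)|^p\,dt .$$ Since $\kappa$ and $r$ are defined only almost everywhere, their limits are understood in the essential sense (up to null sets). If $\kappa(s)\to0$ and $r(s)\to0$ as $|s|\to\infty$, then $\lambda_\infty(\Omega_{\kappa,R})=\lambda_1(\omega)$. More precisely: * if $\kappa(s)\to0$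 as $|s|\to\infty$, then $\lambda_\infty(\Omega_{\kappa,R})\ge\lambda_1(\omega)$; * if $\kappa(s)\to0$ and $r(s)\to0$ as $s\to+\infty$, then $\lambda_\infty(\Omega_{\kappa,R})\le\lambda_1(\omega)$. -/

import Mathlib

open scoped ENNReal Topology RealInnerProductSpace
open MeasureTheory Filter

namespace BentTube

noncomputable section

/-- The Euclidean space `ℝ^d`, with its Euclidean norm and Lebesgue measure. -/
abbrev Sp (d : ℕ) : Type := EuclideanSpace ℝ (Fin d)

/-! ### Sobolev spaces and spectral thresholds -/

/-- `φ ∈ C_0^∞(Ω)`: smooth, with compact support contained in `Ω`. -/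
structure IsTestFunction {d : ℕ} (Ω : Set (Sp d)) (φ : Sp d → ℝ) : Prop where
  smooth : ContDiff ℝ (⊤ : ℕ∞) φ
  compact : HasCompactSupport φ
  support_subset : tsupport φ ⊆ Ω

/-- `g` is the weak gradient of `u` in `Ω`. -/
def IsWeakGradient {d : ℕ} (Ω : Set (Sp d)) (u : Sp d → ℝ) (g : Sp d → Sp d) : Prop :=
  ∀ φ : Sp d → ℝ, IsTestFunction Ω φ → ∀ i : Fin d,
    ∫ x in Ω, u x * (gradient φ x) i = - ∫ x in Ω, (g x) i * φ x

/-- `u ∈ W^{1,p}(Ω)`, with weak gradient `g`. -/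
structure MemW {d : ℕ} (p : ℝ) (Ω : Set (Sp d)) (u : Sp d → ℝ) (g : Sp d → Sp d) : Prop where
  memLp : MemLp u (ENNReal.ofReal p) (volume.restrict Ω)
  memLp_grad : MemLp g (ENNReal.ofReal p) (volume.restrict Ω)
  weakGradient : IsWeakGradient Ω u g

/-- `u ∈ W_0^{1,p}(Ω)`, with weak gradient `g`: the function `u` belongs to the closure of
`C_0^∞(Ω)` in `W^{1,p}(Ω)`. -/
structure MemW0 {d : ℕ} (p : ℝ) (Ω : Set (Sp d)) (u : Sp d → ℝ) (g : Sp d → Sp d) : Prop where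
  memW : MemW p Ω u g
  approx : ∀ ε : ℝ≥0∞, 0 < ε → ∃ φ : Sp d → ℝ, IsTestFunction Ω φ ∧
    eLpNorm (fun x => u x - φ x) (ENNReal.ofReal p) (volume.restrict Ω) < ε ∧
    eLpNorm (fun x => g x - gradient φ x) (ENNReal.ofReal p) (volume.restrict Ω) < ε

/-- The spectral threshold `λ₁(Ω)` of the Dirichlet `p`-Laplacian: the infimum of the Rayleigh
quotient over the non-zero elements of `W_0^{1,p}(Ω)`. -/
def spectralThreshold {d : ℕ} (p : ℝ) (Ω : Set (Sp d)) : ℝ≥0∞ :=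
  ⨅ (u : Sp d → ℝ) (g : Sp d → Sp d) (_ : MemW0 p Ω u g)
    (_ : ¬ u =ᵐ[volume.restrict Ω] 0),
    (∫⁻ x in Ω, ‖g x‖ₑ ^ p) / (∫⁻ x in Ω, ‖u x‖ₑ ^ p)

/-- The essential spectral threshold `λ_∞(Ω)`: the supremum of `λ₁(Ω ∖ K)` over compact
`K ⊆ Ω`. -/
def essSpectralThreshold {d : ℕ} (p : ℝ) (Ω : Set (Sp d)) : ℝ≥0∞ :=
  ⨆ (K : Set (Sp d)) (_ : IsCompact K) (_ : K ⊆ Ω), spectralThreshold p (Ω \ K)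

/-- `φ` (with weak gradient `g`) is the first eigenfunction of `ω`: the positive minimiser of the
Rayleigh quotient in `W_0^{1,p}(ω)`, normalised to `1` in `L^p(ω)`. -/
structure IsFirstEigenfunction {n : ℕ} (p : ℝ) (ω : Set (Sp n)) (φ : Sp n → ℝ)
    (g : Sp n → Sp n) : Prop where
  memW0 : MemW0 p ω φ g
  pos : ∀ᵐ t ∂(volume.restrict ω), 0 < φ t
  normalised : ∫⁻ t in ω, ‖φ t‖ₑ ^ p = 1
  minimiser : ∫⁻ t in ω, ‖g t‖ₑ ^ p = spectralThreshold p ω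

/-! ### Geometry of the tube -/

/-- `Γ` is a unit-speed curve of class `C^{1,1}` (locally Lipschitz derivative). -/
structure IsUnitSpeedC11 {d : ℕ} (Γ : ℝ → Sp d) : Prop where
  differentiable : Differentiable ℝ Γ
  locallyLipschitz_deriv : LocallyLipschitz (deriv Γ)
  unit_speed : ∀ s, ‖deriv Γ s‖ = 1

/-- The curvature `κ = |Γ''|`, which for a `C^{1,1}` curve is well defined almost everywhere. -/
def curvature {d : ℕ} (Γ : ℝ → Sp d) (s : ℝ) : ℝ := ‖deriv (deriv Γ) s‖

/-- `(T, N_1, …, N_n)`, with `T = Γ'`, is a relatively parallel adapted frame of `Γ` with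
curvature functions `k_1, …, k_n`: it is orthonormal, locally Lipschitz, and almost everywhere
`T' = ∑ k_j N_j` and `N_j' = - k_j T`. -/
structure IsRelativelyParallelFrame {n : ℕ} (Γ : ℝ → Sp (n + 1))
    (N : Fin n → ℝ → Sp (n + 1)) (k : Fin n → ℝ → ℝ) : Prop where
  orthonormal : ∀ s, Orthonormal ℝ (fun j => N j s)
  normal : ∀ j s, ⟪deriv Γ s, N j s⟫ = 0
  locallyLipschitz : ∀ j, LocallyLipschitz (N j)
  tangent_deriv : ∀ᵐ s : ℝ, HasDerivAt (deriv Γ) (∑ j, k j s • N j s) s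
  normal_deriv : ∀ j, ∀ᵐ s : ℝ, HasDerivAt (N j) (-(k j s • deriv Γ s)) s

/-- `R` is a locally Lipschitz family of rotations: `R(s) ∈ SO(n)`, `R' ∈ L^∞_loc`. -/
structure IsRotationFamily {n : ℕ} (R : ℝ → Matrix (Fin n) (Fin n) ℝ) : Prop where
  mem_SO : ∀ s, R s ∈ Matrix.specialOrthogonalGroup (Fin n) ℝ
  locallyLipschitz : ∀ μ ν, LocallyLipschitz (fun s => R s μ ν)

/-- The map `(s, t) ↦ Γ(s) + t_μ R_{μν}(s) N_ν(s)`. -/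
def tubeMap {n : ℕ} (Γ : ℝ → Sp (n + 1)) (N : Fin n → ℝ → Sp (n + 1))
    (R : ℝ → Matrix (Fin n) (Fin n) ℝ) (x : ℝ × Sp n) : Sp (n + 1) :=
  Γ x.1 + ∑ μ, ∑ ν, (x.2 μ * R x.1 μ ν) • N ν x.1

/-- The bent twisted tube about `Γ` with cross-section `ω`. -/
def tube {n : ℕ} (Γ : ℝ → Sp (n + 1)) (N : Fin n → ℝ → Sp (n + 1))
    (R : ℝ → Matrix (Fin n) (Fin n) ℝ) (ω : Set (Sp n)) : Set (Sp (n + 1)) :=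
  tubeMap Γ N R '' (Set.univ ×ˢ ω)

/-- The twisting coefficients `f_μ(s,t) = t_α R'_{αβ}(s) R_{μβ}(s)`. -/
def twistCoeff {n : ℕ} (R : ℝ → Matrix (Fin n) (Fin n) ℝ) (μ : Fin n) (s : ℝ) (t : Sp n) : ℝ :=
  ∑ α, ∑ β, t α * deriv (fun s' => R s' α β) s * R s μ β

/-- `∫_ω |f_μ(s,t) g_μ(t)|^p dt`, where `g` is to be the gradient of the first eigenfunction. -/
def twistEnergy {n : ℕ} (p : ℝ) (R : ℝ → Matrix (Fin n) (Fin n) ℝ) (ω : Set (Sp n))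
    (g : Sp n → Sp n) (s : ℝ) : ℝ≥0∞ :=
  ∫⁻ t in ω, ‖∑ μ, twistCoeff R μ s t * (g t) μ‖ₑ ^ p

/-- The tube does not overlap itself: `a ‖κ‖_{L^∞} < 1`, where `a = sup_{t ∈ ω} |t|`, and the
tube map is injective on `ℝ × ω`. -/
structure IsNonOverlapping {n : ℕ} (Γ : ℝ → Sp (n + 1)) (N : Fin n → ℝ → Sp (n + 1))
    (R : ℝ → Matrix (Fin n) (Fin n) ℝ) (ω : Set (Sp n)) : Prop where
  curvature_bound : (⨆ t ∈ ω, ‖t‖ₑ) * eLpNorm (curvature Γ) ∞ volume < 1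
  injOn : Set.InjOn (tubeMap Γ N R) (Set.univ ×ˢ ω)

end

end BentTube

/-!
The tube is the image of the straight tube `ℝ × ω` under `L(s, t) = Γ(s) + t_μ E_μ(s)`, where
`E_μ = R_{μν} N_ν` is a locally Lipschitz orthonormal frame of the normal planes. Since `a ‖κ‖ < 1`,
the tangential component of `Γ(s) - L(s', t')` is comparable to `s - s'` on a uniform scale. Hence
`L` is open (`IsAdaptedFrame.image_mem_nhds`) and locally bi-Lipschitz
(`IsAdaptedFrame.exists_dist_le`), and integrals over the tube become integrals over `ℝ × ω` with
the Jacobian `h = 1 - t_μ ⟨E_μ, T'⟩`, where `|h - 1| ≤ a κ(s)`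
(`IsAdaptedFrame.lintegral_image_frameMap`).

*Lower bound.* For fixed `s` the map `L(s, ·)` is an affine isometry, so the section
`u(L(s, ·))` of a test function of the tube is a test function on `ω` whose gradient is dominated
by that of `u`. Far out, `h` is close to one, and the Rayleigh quotient of the section is at least
`λ₁(ω)`. The compact set to be removed is `L([-s₁, s₁] × C)`, with `C ⊂ ω` compact and `ω ∖ C` of
small volume: then for `|s| ≤ s₁` the section lives on `ω ∖ C`, and its Rayleigh quotient is as
large as desired, by a Faber–Krahn type estimate which follows from the Gagliardo–Nirenberg–Sobolev
inequality (`exists_measure_le_imp_mul_lintegral_le`).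

*Upper bound.* The trial function is `ρ(s) ψ(t)`, where `ψ` is a test function close to the first
eigenfunction and `ρ` a long trapezoidal cutoff with small slopes far out in the tube. Its gradient
has the normal part `ρ ∇ψ` and the tangential part `h⁻¹ (ρ' ψ - ρ f_μ ∂_μ ψ)`, which is small in
`L^p` by the decay of the twist energy. As `L⁻¹` is only Lipschitz, so is the trial function;
Lipschitz functions with compact support are admissible by mollification
(`spectralThreshold_mul_le_of_lipschitzWith`).
-/

namespace BentTube

/-! ### Rayleigh quotients of test functions -/

theorem eLpNorm_ofReal_rpow {α E : Type*} [MeasurableSpace α] [NormedAddCommGroup E]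
    {μ : Measure α} {p : ℝ} (hp : 0 < p) (f : α → E) :
    eLpNorm f (ENNReal.ofReal p) μ ^ p = ∫⁻ x, ‖f x‖ₑ ^ p ∂μ := by
  rw [eLpNorm_eq_lintegral_rpow_enorm_toReal (by simpa using hp) (by simp),
    ENNReal.toReal_ofReal hp.le, ← ENNReal.rpow_mul, one_div, inv_mul_cancel₀ hp.ne',
    ENNReal.rpow_one]

theorem gradient_apply {d : ℕ} (φ : Sp d → ℝ) (x : Sp d) (i : Fin d) :
    (gradient φ x) i = fderiv ℝ φ x (EuclideanSpace.single i 1) := by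
  have h := InnerProductSpace.toDual_symm_apply (𝕜 := ℝ) (x := EuclideanSpace.single i (1 : ℝ))
    (y := fderiv ℝ φ x)
  rw [← h, EuclideanSpace.inner_single_right]
  simp [gradient]

theorem norm_gradient {d : ℕ} (φ : Sp d → ℝ) (x : Sp d) :
    ‖gradient φ x‖ = ‖fderiv ℝ φ x‖ := by
  simp [gradient]

theorem enorm_gradient {d : ℕ} (φ : Sp d → ℝ) (x : Sp d) :
    ‖gradient φ x‖ₑ = ‖fderiv ℝ φ x‖ₑ := by
  rw [← ofReal_norm, ← ofReal_norm, norm_gradient]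

namespace IsTestFunction

variable {d : ℕ} {Ω : Set (Sp d)} {φ : Sp d → ℝ}

theorem eq_zero (h : IsTestFunction Ω φ) {x : Sp d} (hx : x ∉ Ω) : φ x = 0 :=
  image_eq_zero_of_notMem_tsupport fun h' => hx (h.support_subset h')

theorem fderiv_eq_zero (h : IsTestFunction Ω φ) {x : Sp d} (hx : x ∉ Ω) : fderiv ℝ φ x = 0 :=
  fderiv_of_notMem_tsupport (𝕜 := ℝ) fun h' => hx (h.support_subset h')

theorem differentiable (h : IsTestFunction Ω φ) : Differentiable ℝ φ :=
  h.smooth.differentiable (by simp)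

theorem continuous_fderiv (h : IsTestFunction Ω φ) : Continuous (fderiv ℝ φ) :=
  h.smooth.continuous_fderiv (by simp)

theorem continuous_gradient (h : IsTestFunction Ω φ) : Continuous (gradient φ) :=
  (InnerProductSpace.toDual ℝ (Sp d)).symm.continuous.comp h.continuous_fderiv

theorem hasCompactSupport_gradient (h : IsTestFunction Ω φ) : HasCompactSupport (gradient φ) :=
  (h.compact.fderiv ℝ).comp_left (g := (InnerProductSpace.toDual ℝ (Sp d)).symm) (map_zero _)

theorem mono (h : IsTestFunction Ω φ) {Ω' : Set (Sp d)} (hΩ : Ω ⊆ Ω') : IsTestFunction Ω' φ :=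
  ⟨h.smooth, h.compact, h.support_subset.trans hΩ⟩

theorem setLIntegral_enorm (h : IsTestFunction Ω φ) {p : ℝ} (hp : 0 < p) :
    ∫⁻ x in Ω, ‖φ x‖ₑ ^ p = ∫⁻ x, ‖φ x‖ₑ ^ p := by
  refine setLIntegral_eq_of_support_subset ?_
  intro x hx
  by_contra h'
  simp [h.eq_zero h', hp] at hx

theorem setLIntegral_enorm_gradient (h : IsTestFunction Ω φ) {p : ℝ} (hp : 0 < p) :
    ∫⁻ x in Ω, ‖gradient φ x‖ₑ ^ p = ∫⁻ x, ‖fderiv ℝ φ x‖ₑ ^ p := by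
  simp_rw [enorm_gradient]
  refine setLIntegral_eq_of_support_subset ?_
  intro x hx
  by_contra h'
  rw [Function.mem_support, h.fderiv_eq_zero h', ← ofReal_norm, norm_zero, ENNReal.ofReal_zero,
    ENNReal.zero_rpow_of_pos hp] at hx
  exact hx rfl

theorem isWeakGradient (h : IsTestFunction Ω φ) : IsWeakGradient Ω φ (gradient φ) := by
  intro ψ hψ i
  have e1 : ∫ x in Ω, φ x * (gradient ψ x) i = ∫ x, φ x * (gradient ψ x) i := by
    refine setIntegral_eq_integral_of_forall_compl_eq_zero fun x hx => ?_
    simp [h.eq_zero hx]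
  have e2 : ∫ x in Ω, (gradient φ x) i * ψ x = ∫ x, (gradient φ x) i * ψ x := by
    refine setIntegral_eq_integral_of_forall_compl_eq_zero fun x hx => ?_
    simp [hψ.eq_zero hx]
  rw [e1, e2]
  simp_rw [gradient_apply]
  have c1 : Continuous fun x => fderiv ℝ φ x (EuclideanSpace.single i 1) :=
    h.continuous_fderiv.clm_apply continuous_const
  have c2 : Continuous fun x => fderiv ℝ ψ x (EuclideanSpace.single i 1) :=
    hψ.continuous_fderiv.clm_apply continuous_const
  refine integral_mul_fderiv_eq_neg_fderiv_mul_of_integrable ?_ ?_ ?_ (fun x _ => h.differentiable x)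
    (fun x _ => hψ.differentiable x)
  · exact (c1.mul hψ.smooth.continuous).integrable_of_hasCompactSupport hψ.compact.mul_left
  · exact (h.smooth.continuous.mul c2).integrable_of_hasCompactSupport h.compact.mul_right
  · exact (h.smooth.continuous.mul hψ.smooth.continuous).integrable_of_hasCompactSupport
      h.compact.mul_right

theorem memW0 (h : IsTestFunction Ω φ) (p : ℝ) : MemW0 p Ω φ (gradient φ) where
  memW := ⟨(h.smooth.continuous.memLp_of_hasCompactSupport h.compact).restrict _,
    (h.continuous_gradient.memLp_of_hasCompactSupport h.hasCompactSupport_gradient).restrict _,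
    h.isWeakGradient⟩
  approx ε hε := ⟨φ, h, by simpa using hε, by simpa using hε⟩

end IsTestFunction

theorem MemW0.spectralThreshold_mul_le {d : ℕ} {p : ℝ} (hp : 0 < p) {Ω : Set (Sp d)}
    {u : Sp d → ℝ} {g : Sp d → Sp d} (h : MemW0 p Ω u g) :
    spectralThreshold p Ω * ∫⁻ x in Ω, ‖u x‖ₑ ^ p ≤ ∫⁻ x in Ω, ‖g x‖ₑ ^ p := by
  by_cases hu : u =ᵐ[volume.restrict Ω] 0
  · have : ∫⁻ x in Ω, ‖u x‖ₑ ^ p = 0 := by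
      rw [← eLpNorm_ofReal_rpow hp, eLpNorm_congr_ae hu, eLpNorm_zero, ENNReal.zero_rpow_of_pos hp]
    simp [this]
  · refine ENNReal.mul_le_of_le_div ?_
    exact iInf_le_of_le u (iInf_le_of_le g (iInf_le_of_le h (iInf_le_of_le hu le_rfl)))

theorem IsTestFunction.spectralThreshold_mul_le {d : ℕ} {p : ℝ} (hp : 0 < p) {Ω : Set (Sp d)}
    {φ : Sp d → ℝ} (h : IsTestFunction Ω φ) :
    spectralThreshold p Ω * ∫⁻ x, ‖φ x‖ₑ ^ p ≤ ∫⁻ x, ‖fderiv ℝ φ x‖ₑ ^ p := by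
  have := (h.memW0 p).spectralThreshold_mul_le hp
  rwa [h.setLIntegral_enorm hp, h.setLIntegral_enorm_gradient hp] at this

/-- By density, a lower bound for the Rayleigh quotients of test functions is a lower bound for
the spectral threshold. -/
theorem le_spectralThreshold {d : ℕ} {p : ℝ} (hp : 1 ≤ p) {Ω : Set (Sp d)} {c : ℝ≥0∞}
    (hc : c ≠ ∞) (h : ∀ φ : Sp d → ℝ, IsTestFunction Ω φ →
      c * ∫⁻ x, ‖φ x‖ₑ ^ p ≤ ∫⁻ x, ‖fderiv ℝ φ x‖ₑ ^ p) :
    c ≤ spectralThreshold p Ω := by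
  have hp0 : 0 < p := by linarith
  refine le_iInf fun u => le_iInf fun g => le_iInf fun hu => le_iInf fun hu0 => ?_
  have hp' : 1 ≤ ENNReal.ofReal p := by simpa using hp
  have key : c ^ p⁻¹ * eLpNorm u (ENNReal.ofReal p) (volume.restrict Ω)
      ≤ eLpNorm g (ENNReal.ofReal p) (volume.restrict Ω) := by
    have hc' : c ^ p⁻¹ ≠ ∞ := ENNReal.rpow_ne_top_of_nonneg (by positivity) hc
    have hlim : Tendsto (fun ε : ℝ≥0∞ => eLpNorm g (ENNReal.ofReal p) (volume.restrict Ω) +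
        (ε + c ^ p⁻¹ * ε)) (𝓝[>] 0) (𝓝 (eLpNorm g (ENNReal.ofReal p) (volume.restrict Ω) +
        (0 + c ^ p⁻¹ * 0))) := by
      refine Tendsto.mono_left ?_ nhdsWithin_le_nhds
      exact tendsto_const_nhds.add (tendsto_id.add (ENNReal.Tendsto.const_mul tendsto_id (.inr hc')))
    rw [mul_zero, add_zero, add_zero] at hlim
    refine ge_of_tendsto hlim ?_
    filter_upwards [self_mem_nhdsWithin] with ε hε
    obtain ⟨φ, hφ, h1, h2⟩ := hu.approx ε hε
    have hφ' : c ^ p⁻¹ * eLpNorm φ (ENNReal.ofReal p) (volume.restrict Ω)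
        ≤ eLpNorm (gradient φ) (ENNReal.ofReal p) (volume.restrict Ω) := by
      rw [← ENNReal.rpow_le_rpow_iff hp0, ENNReal.mul_rpow_of_nonneg _ _ hp0.le,
        eLpNorm_ofReal_rpow hp0, eLpNorm_ofReal_rpow hp0, hφ.setLIntegral_enorm hp0,
        hφ.setLIntegral_enorm_gradient hp0, ENNReal.rpow_inv_rpow hp0.ne']
      exact h φ hφ
    have mφ := hφ.smooth.continuous.aestronglyMeasurable (μ := volume.restrict Ω)
    have mφ' := hφ.continuous_gradient.aestronglyMeasurable (μ := volume.restrict Ω)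
    have t1 : eLpNorm u (ENNReal.ofReal p) (volume.restrict Ω)
        ≤ eLpNorm φ (ENNReal.ofReal p) (volume.restrict Ω) + ε := by
      calc _ = eLpNorm (φ + fun x => u x - φ x) (ENNReal.ofReal p) (volume.restrict Ω) := by
            congr 1; ext x; simp
        _ ≤ _ := eLpNorm_add_le mφ (hu.memW.memLp.1.sub mφ) hp'
        _ ≤ _ := by gcongr
    have t2 : eLpNorm (gradient φ) (ENNReal.ofReal p) (volume.restrict Ω)
        ≤ eLpNorm g (ENNReal.ofReal p) (volume.restrict Ω) + ε := by
      calc _ = eLpNorm (g - fun x => g x - gradient φ x) (ENNReal.ofReal p)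
              (volume.restrict Ω) := by
            congr 1; ext x; simp
        _ ≤ _ := eLpNorm_sub_le hu.memW.memLp_grad.1 (hu.memW.memLp_grad.1.sub mφ') hp'
        _ ≤ _ := by gcongr
    calc _ ≤ c ^ p⁻¹ * (eLpNorm φ (ENNReal.ofReal p) (volume.restrict Ω) + ε) := by gcongr
      _ = c ^ p⁻¹ * eLpNorm φ (ENNReal.ofReal p) (volume.restrict Ω) + c ^ p⁻¹ * ε := mul_add ..
      _ ≤ (eLpNorm g (ENNReal.ofReal p) (volume.restrict Ω) + ε) + c ^ p⁻¹ * ε := by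
        gcongr; exact hφ'.trans t2
      _ = _ := add_assoc ..
  have key' := ENNReal.rpow_le_rpow key hp0.le
  rw [ENNReal.mul_rpow_of_nonneg _ _ hp0.le, ENNReal.rpow_inv_rpow hp0.ne',
    eLpNorm_ofReal_rpow hp0, eLpNorm_ofReal_rpow hp0] at key'
  rw [ENNReal.le_div_iff_mul_le]
  · exact key'
  · left
    rw [← eLpNorm_ofReal_rpow hp0]
    intro h0
    rw [ENNReal.rpow_eq_zero_iff_of_pos hp0, eLpNorm_eq_zero_iff hu.memW.memLp.1
      (by simpa using hp0)] at h0
    exact hu0 h0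
  · left
    rw [← eLpNorm_ofReal_rpow hp0]
    exact ENNReal.rpow_ne_top_of_nonneg hp0.le hu.memW.memLp.2.ne

/-! ### Lipschitz competitors -/

open scoped Convolution NNReal in
/-- A Lipschitz function may be differentiated under a convolution: it is differentiable almost
everywhere, and its difference quotients are dominated by the Lipschitz constant. -/
theorem hasFDerivAt_convolution_of_lipschitzWith {E : Type*} [NormedAddCommGroup E]
    [NormedSpace ℝ E] [FiniteDimensional ℝ E] [MeasurableSpace E] [BorelSpace E]
    {μ : Measure E} [μ.IsAddHaarMeasure] {η v : E → ℝ} (hη : Continuous η)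
    (hη' : HasCompactSupport η) {C : ℝ≥0} (hv : LipschitzWith C v) (x : E) :
    HasFDerivAt (η ⋆[ContinuousLinearMap.lsmul ℝ ℝ, μ] v)
      ((η ⋆[ContinuousLinearMap.lsmul ℝ ℝ, μ] (fderiv ℝ v)) x) x := by
  have hηi : Integrable η μ := hη.integrable_of_hasCompactSupport hη'
  refine (hasFDerivAt_integral_of_dominated_loc_of_lip (s := Set.univ)
    (F := fun x t => ContinuousLinearMap.lsmul ℝ ℝ (η t) (v (x - t)))
    (F' := fun t => ContinuousLinearMap.lsmul ℝ ℝ (η t) (fderiv ℝ v (x - t)))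
    (bound := fun t => |η t| * C) univ_mem ?_ ?_ ?_ ?_ ?_ ?_).2
  · refine Eventually.of_forall fun y => ?_
    exact (hη.smul (hv.continuous.comp (continuous_const.sub continuous_id))).aestronglyMeasurable
  · refine Continuous.integrable_of_hasCompactSupport
      (hη.smul (hv.continuous.comp (continuous_const.sub continuous_id))) ?_
    exact hη'.smul_right
  · refine AEStronglyMeasurable.smul hη.aestronglyMeasurable ?_
    exact ((measurable_fderiv ℝ v).comp (measurable_const.sub measurable_id)).aestronglyMeasurable
  · refine Eventually.of_forall fun t => LipschitzOnWith.of_dist_le_mul fun a _ b _ => ?_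
    have := hv.dist_le_mul (a - t) (b - t)
    rw [dist_sub_right, Real.dist_eq] at this
    simp only [ContinuousLinearMap.lsmul_apply, smul_eq_mul, Real.dist_eq, ← mul_sub, abs_mul]
    simp only [Real.coe_nnabs, abs_mul, abs_abs, NNReal.abs_eq]
    nlinarith [abs_nonneg (η t)]
  · exact hηi.abs.mul_const _
  · have h1 : ∀ᵐ t ∂μ, DifferentiableAt ℝ v (x - t) :=
      (quasiMeasurePreserving_sub_left μ x).ae hv.ae_differentiableAt
    filter_upwards [h1] with t ht
    have h2 : HasFDerivAt (fun y => v (y - t)) (fderiv ℝ v (x - t)) x := by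
      simpa [Function.comp_def] using ht.hasFDerivAt.comp x ((hasFDerivAt_id x).sub_const t)
    exact h2.const_smul (η t)

open scoped Convolution NNReal in
/-- Lipschitz functions with compact support in `U` are admissible in the definition of the
spectral threshold: their mollifications are test functions, and the `p`-energies converge. -/
theorem spectralThreshold_mul_le_of_lipschitzWith {d : ℕ} {p : ℝ} (hp : 0 < p) {U : Set (Sp d)}
    (hU : IsOpen U) {C : ℝ≥0} {v : Sp d → ℝ} (hv : LipschitzWith C v)
    (hc : HasCompactSupport v) (hs : tsupport v ⊆ U) :
    spectralThreshold p U * ∫⁻ x, ‖v x‖ₑ ^ p ≤ ∫⁻ x, ‖fderiv ℝ v x‖ₑ ^ p := by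
  rcases eq_or_ne (∫⁻ x, ‖v x‖ₑ ^ p) 0 with h0 | h0
  · simp [h0]
  -- The ratio of the two radii is bounded, as the a.e. convergence of the mollified derivatives needs.
  let φ : ℕ → ContDiffBump (0 : Sp d) := fun k =>
    ⟨1 / (2 * ((k : ℝ) + 1)), 1 / ((k : ℝ) + 1), by positivity, by
      apply one_div_lt_one_div_of_lt <;> nlinarith [Nat.cast_nonneg (α := ℝ) k]⟩
  have hφ : Tendsto (fun k => (φ k).rOut) atTop (𝓝 0) := tendsto_one_div_add_atTop_nhds_zero_nat
  let η : ℕ → Sp d → ℝ := fun k => (φ k).normed volume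
  let w : ℕ → Sp d → ℝ := fun k => η k ⋆[ContinuousLinearMap.lsmul ℝ ℝ, volume] v
  obtain ⟨r, hr, hrU⟩ := hc.isCompact.exists_cthickening_subset_open hU hs
  have hηs : ∀ k, ContDiff ℝ (⊤ : ℕ∞) (η k) := fun k => (φ k).contDiff_normed
  have hηc : ∀ k, HasCompactSupport (η k) := fun k => (φ k).hasCompactSupport_normed
  have hsupp : ∀ k, tsupport (w k) ⊆ Metric.cthickening (φ k).rOut (tsupport v) := by
    intro k
    refine closure_minimal ?_ Metric.isClosed_cthickening
    refine (support_convolution_subset _).trans ?_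
    rintro _ ⟨a, ha, b, hb, rfl⟩
    rw [(φ k).support_normed_eq] at ha
    refine Metric.mem_cthickening_of_dist_le _ b _ _ (subset_tsupport _ hb) ?_
    rw [dist_eq_norm, add_sub_cancel_right]
    exact (mem_ball_zero_iff.1 ha).le
  have hwc : ∀ k, HasCompactSupport (w k) := fun k => (hηc k).convolution _ hc
  have hwd : ∀ k x, HasFDerivAt (w k)
      ((η k ⋆[ContinuousLinearMap.lsmul ℝ ℝ, volume] (fderiv ℝ v)) x) x := fun k x =>
    hasFDerivAt_convolution_of_lipschitzWith (hηs k).continuous (hηc k) hv x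
  have htest : ∀ᶠ k in atTop, IsTestFunction U (w k) := by
    filter_upwards [hφ.eventually (gt_mem_nhds hr)] with k hk
    refine ⟨(hηc k).contDiff_convolution_left _ (hηs k) hv.continuous.locallyIntegrable, hwc k, ?_⟩
    exact (hsupp k).trans ((Metric.cthickening_mono hk.le _).trans hrU)
  let K := Metric.cthickening 1 (tsupport v)
  have hK : IsCompact K := hc.isCompact.cthickening
  have hrk : ∀ k, (φ k).rOut ≤ 1 := fun k => by
    change 1 / ((k : ℝ) + 1) ≤ 1
    rw [div_le_one (by positivity)]
    linarith [Nat.cast_nonneg (α := ℝ) k]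
  have hwK : ∀ k, tsupport (w k) ⊆ K := fun k =>
    (hsupp k).trans (Metric.cthickening_mono (hrk k) _)
  obtain ⟨M, hM⟩ := hc.exists_bound_of_continuous hv.continuous
  have hbd : ∀ {F : Type} [NormedAddCommGroup F] [NormedSpace ℝ F] (f : Sp d → F) (B : ℝ),
      (∀ x, ‖f x‖ ≤ B) → ∀ k x, ‖(η k ⋆[ContinuousLinearMap.lsmul ℝ ℝ, volume] f) x‖ ≤ B := by
    intro F _ _ f B hB k x
    calc _ ≤ ∫ t, η k t * B := by
          refine norm_integral_le_of_norm_le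
            (((hηs k).continuous.integrable_of_hasCompactSupport (hηc k)).mul_const _) ?_
          refine Eventually.of_forall fun t => ?_
          have h1 : 0 ≤ η k t := (φ k).nonneg_normed t
          simp only [ContinuousLinearMap.lsmul_apply, norm_smul, Real.norm_eq_abs,
            abs_of_nonneg h1]
          exact mul_le_mul_of_nonneg_left (hB _) h1
      _ = B := by
          rw [integral_mul_const, (φ k).integral_normed, one_mul]
  have hfin : ∀ B : ℝ, ∫⁻ x, K.indicator (fun _ => ENNReal.ofReal B ^ p) x ≠ ∞ := by
    intro B
    rw [lintegral_indicator hK.isClosed.measurableSet, setLIntegral_const]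
    exact ENNReal.mul_ne_top (ENNReal.rpow_ne_top_of_nonneg hp.le ENNReal.ofReal_ne_top)
      hK.measure_lt_top.ne
  have t1 : Tendsto (fun k => ∫⁻ x, ‖w k x‖ₑ ^ p) atTop (𝓝 (∫⁻ x, ‖v x‖ₑ ^ p)) := by
    refine tendsto_lintegral_of_dominated_convergence'
      (K.indicator (fun _ => ENNReal.ofReal M ^ p)) ?_ ?_ (hfin M) ?_
    · intro k
      exact (((hηc k).contDiff_convolution_left _ (hηs k)
        hv.continuous.locallyIntegrable).continuous.enorm.measurable.pow_const p).aemeasurable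
    · refine fun k => Eventually.of_forall fun x => ?_
      by_cases hx : x ∈ K
      · rw [Set.indicator_of_mem hx]
        beta_reduce
        rw [← ofReal_norm]
        gcongr
        exact hbd v M hM k x
      · simp [image_eq_zero_of_notMem_tsupport fun h => hx (hwK k h), hp]
    · refine Eventually.of_forall fun x => ?_
      exact ((ContDiffBump.convolution_tendsto_right_of_continuous hφ hv.continuous
        x).enorm).ennrpow_const p
  have t2 : Tendsto (fun k => ∫⁻ x, ‖fderiv ℝ (w k) x‖ₑ ^ p) atTop
      (𝓝 (∫⁻ x, ‖fderiv ℝ v x‖ₑ ^ p)) := by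
    have hDb : ∀ x, ‖fderiv ℝ v x‖ ≤ C := fun x => norm_fderiv_le_of_lipschitz ℝ hv
    have hli : LocallyIntegrable (fderiv ℝ v) (volume : Measure (Sp d)) := by
      refine (locallyIntegrable_const (C : ℝ)).mono
        (measurable_fderiv ℝ v).aestronglyMeasurable (Eventually.of_forall fun x => ?_)
      simpa using hDb x
    refine tendsto_lintegral_of_dominated_convergence'
      (K.indicator (fun _ => ENNReal.ofReal C ^ p)) ?_ ?_ (hfin C) ?_
    · intro k
      exact ((measurable_fderiv ℝ (w k)).enorm.pow_const p).aemeasurable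
    · refine fun k => Eventually.of_forall fun x => ?_
      by_cases hx : x ∈ K
      · rw [Set.indicator_of_mem hx]
        beta_reduce
        rw [(hwd k x).fderiv, ← ofReal_norm]
        gcongr
        exact hbd _ C hDb k x
      · have h : fderiv ℝ (w k) x = 0 := fderiv_of_notMem_tsupport (𝕜 := ℝ) fun h => hx (hwK k h)
        beta_reduce
        rw [h, ← ofReal_norm, norm_zero, ENNReal.ofReal_zero, ENNReal.zero_rpow_of_pos hp]
        exact zero_le
    · have h := ContDiffBump.ae_convolution_tendsto_right_of_locallyIntegrable (φ := φ) (K := 2)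
        hφ (Eventually.of_forall fun k => by
          change 1 / ((k : ℝ) + 1) ≤ 2 * (1 / (2 * ((k : ℝ) + 1)))
          field_simp; rfl) hli
      filter_upwards [h] with x hx
      simp_rw [fun k => (hwd k x).fderiv]
      exact (hx.enorm).ennrpow_const p
  refine le_of_tendsto_of_tendsto (ENNReal.Tendsto.const_mul t1 (.inl h0)) t2 ?_
  filter_upwards [htest] with k hk using hk.spectralThreshold_mul_le hp

/-! ### A Poincaré inequality on sets of small volume -/

open scoped NNReal in
/-- The `L¹` Poincaré inequality on a set of finite volume: the fundamental theorem of calculus on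
the line, the Gagliardo–Nirenberg–Sobolev and Hölder inequalities in higher dimensions. -/
theorem exists_lintegral_enorm_le_measure_rpow_mul {n : ℕ} (hn : 1 ≤ n) :
    ∃ C : ℝ≥0, ∃ α : ℝ, 0 < α ∧ ∀ w : Sp n → ℝ, ContDiff ℝ 1 w → HasCompactSupport w →
      ∀ S : Set (Sp n), Function.support w ⊆ S →
        ∫⁻ x, ‖w x‖ₑ ≤ C * volume S ^ α * ∫⁻ x, ‖fderiv ℝ w x‖ₑ := by
  have hset : ∀ (w : Sp n → ℝ) (S : Set (Sp n)), Function.support w ⊆ S →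
      ∫⁻ x, ‖w x‖ₑ = ∫⁻ x in S, ‖w x‖ₑ := fun w S hS => by
    refine (setLIntegral_eq_of_support_subset fun x hx => hS ?_).symm
    intro h
    simp [h] at hx
  rcases eq_or_lt_of_le hn with rfl | hn
  · refine ⟨1, 1, one_pos, fun w hw hc S hS => ?_⟩
    let ι : ℝ ≃ₗᵢ[ℝ] Sp 1 := (OrthonormalBasis.singleton (Fin 1) ℝ).repr
    have hsup : ∀ x, ‖w x‖ₑ ≤ ∫⁻ y, ‖fderiv ℝ w y‖ₑ := by
      intro x
      have h1 := HasCompactSupport.enorm_le_lintegral_Ici_deriv (f := w ∘ ι)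
        (hw.comp ι.toContinuousLinearEquiv.contDiff) (hc.comp_homeomorph ι.toHomeomorph) (ι.symm x)
      rw [Function.comp_apply, ι.apply_symm_apply] at h1
      refine h1.trans ((setLIntegral_le_lintegral _ _).trans ?_)
      rw [← ι.measurePreserving.lintegral_comp_emb ι.toHomeomorph.measurableEmbedding]
      refine lintegral_mono fun y => ?_
      have h2 : HasDerivAt (w ∘ ι) (fderiv ℝ w (ι y) (ι 1)) y :=
        (hw.differentiable one_ne_zero (ι y)).hasFDerivAt.comp_hasDerivAt y
          (ι.toContinuousLinearEquiv.toContinuousLinearMap.hasDerivAt)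
      rw [h2.deriv, ← ofReal_norm, ← ofReal_norm]
      refine ENNReal.ofReal_le_ofReal ?_
      calc _ ≤ ‖fderiv ℝ w (ι y)‖ * ‖ι 1‖ := ContinuousLinearMap.le_opNorm _ _
        _ = _ := by simp
    rw [hset w S hS]
    calc _ ≤ ∫⁻ x in S, (∫⁻ y, ‖fderiv ℝ w y‖ₑ) := lintegral_mono hsup
      _ = _ := by simp [mul_comm]
  · have hn1 : (1 : ℝ) < n := by exact_mod_cast hn
    let q : ℝ≥0 := (n : ℝ≥0).conjExponent
    have hq : NNReal.HolderConjugate (n : ℝ≥0) q :=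
      NNReal.HolderConjugate.conjExponent (by exact_mod_cast hn)
    refine ⟨eLpNormLESNormFDerivOneConst (volume : Measure (Sp n)) q, 1 - 1 / (q : ℝ), ?_,
      fun w hw hc S hS => ?_⟩
    · have : (1 : ℝ) < q := hq.symm.coe.lt
      rw [sub_pos, div_lt_one (by linarith)]
      exact this
    · have h1 := eLpNorm_le_eLpNorm_fderiv_one (volume : Measure (Sp n)) hw hc
        (p := q) (by simpa using hq)
      have h2 := eLpNorm_le_eLpNorm_mul_rpow_measure_univ (p := 1) (q := q)
        (μ := volume.restrict S) (f := w) (by exact_mod_cast hq.symm.lt.le)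
        hw.continuous.aestronglyMeasurable
      rw [eLpNorm_one_eq_lintegral_enorm, ← hset w S hS, Measure.restrict_apply_univ] at h2
      rw [eLpNorm_one_eq_lintegral_enorm] at h1
      have h3 := eLpNorm_mono_measure w (p := q) (Measure.restrict_le_self (μ := volume) (s := S))
      refine h2.trans ?_
      simp only [ENNReal.toReal_one, ENNReal.coe_toReal, div_one]
      calc _ ≤ (eLpNormLESNormFDerivOneConst (volume : Measure (Sp n)) q
              * ∫⁻ x, ‖fderiv ℝ w x‖ₑ) * volume S ^ (1 - 1 / (q : ℝ)) := by
            gcongr; exact h3.trans h1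
        _ = _ := by ring

open scoped NNReal in
/-- A Faber–Krahn type estimate: functions supported in a set of small volume have a large
Rayleigh quotient. It follows from the `L¹` inequality for `|ψ|^p` and Hölder's inequality. -/
theorem exists_measure_le_imp_mul_lintegral_le {n : ℕ} (hn : 1 ≤ n) {p : ℝ} (hp : 1 < p)
    (M : ℝ≥0) :
    ∃ δ : ℝ≥0∞, 0 < δ ∧ ∀ ψ : Sp n → ℝ, ContDiff ℝ 1 ψ → HasCompactSupport ψ →
      ∀ S : Set (Sp n), volume S ≤ δ → Function.support ψ ⊆ S →
        M * ∫⁻ x, ‖ψ x‖ₑ ^ p ≤ ∫⁻ x, ‖fderiv ℝ ψ x‖ₑ ^ p := by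
  obtain ⟨C, α, hα, hC⟩ := exists_lintegral_enorm_le_measure_rpow_mul hn
  have hp0 : 0 < p := by linarith
  let P : ℝ≥0 := ⟨p, hp0.le⟩
  have hP : (1 : ℝ≥0) < P := hp
  have hpq := Real.HolderConjugate.conjExponent hp
  set q := p.conjExponent
  obtain ⟨δ, hδ0, hδ⟩ : ∃ δ : ℝ≥0∞, 0 < δ ∧ M * (C * δ ^ α * P) ^ p ≤ 1 := by
    have h0 : Tendsto (fun δ : ℝ≥0∞ => M * (C * δ ^ α * P) ^ p) (𝓝[>] 0)
        (𝓝 (M * (C * 0 ^ α * P) ^ p)) := by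
      refine Tendsto.mono_left ?_ nhdsWithin_le_nhds
      refine ENNReal.Tendsto.const_mul (Tendsto.ennrpow_const _ ?_) (.inr ENNReal.coe_ne_top)
      refine ENNReal.Tendsto.mul_const ?_ (.inr ENNReal.coe_ne_top)
      exact ENNReal.Tendsto.const_mul (tendsto_id.ennrpow_const _) (.inr ENNReal.coe_ne_top)
    rw [ENNReal.zero_rpow_of_pos hα, mul_zero, zero_mul, ENNReal.zero_rpow_of_pos hp0,
      mul_zero] at h0
    obtain ⟨δ, h1, h2⟩ := ((h0.eventually (ge_mem_nhds one_pos)).and self_mem_nhdsWithin).exists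
    exact ⟨δ, h2, h1⟩
  refine ⟨δ, hδ0, fun ψ hψ hc S hS hψS => ?_⟩
  set A := ∫⁻ x, ‖ψ x‖ₑ ^ p with hA
  set B := ∫⁻ x, ‖fderiv ℝ ψ x‖ₑ ^ p with hB
  have hAtop : A ≠ ∞ := by
    rw [hA, ← eLpNorm_ofReal_rpow hp0]
    exact ENNReal.rpow_ne_top_of_nonneg hp0.le
      (hψ.continuous.memLp_of_hasCompactSupport hc).eLpNorm_ne_top
  have hw : ContDiff ℝ 1 fun x => ‖ψ x‖ ^ p := hψ.norm_rpow hp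
  have h1 := hC (fun x => ‖ψ x‖ ^ p) hw
    (hc.comp_left (g := fun y : ℝ => ‖y‖ ^ p) (by simp [hp0.ne'])) S (fun x hx => hψS fun h => by
      simp [h, hp0.ne'] at hx)
  have h2 : ∫⁻ x, ‖‖ψ x‖ ^ p‖ₑ = A := by
    refine lintegral_congr fun x => ?_
    rw [Real.enorm_rpow_of_nonneg (norm_nonneg _) hp0.le, enorm_norm]
  have h3 : ∫⁻ x, ‖fderiv ℝ (fun x => ‖ψ x‖ ^ p) x‖ₑ ≤ P * (B ^ (1 / p) * A ^ (1 / q)) := by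
    calc _ ≤ ∫⁻ x, P * (‖fderiv ℝ ψ x‖ₑ * ‖ψ x‖ₑ ^ (p - 1)) := by
          refine lintegral_mono fun x => ?_
          refine (enorm_fderiv_norm_rpow_le (hψ.differentiable one_ne_zero) hP).trans_eq ?_
          rw [mul_assoc, mul_comm (‖ψ x‖ₑ ^ _)]
          rfl
      _ = P * ∫⁻ x, ‖fderiv ℝ ψ x‖ₑ * ‖ψ x‖ₑ ^ (p - 1) := by
          rw [lintegral_const_mul']
          exact ENNReal.coe_ne_top
      _ ≤ _ := by
          gcongr
          have := ENNReal.lintegral_mul_le_Lp_mul_Lq volume hpq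
            (f := fun x => ‖fderiv ℝ ψ x‖ₑ) (g := fun x => ‖ψ x‖ₑ ^ (p - 1))
            (hψ.continuous_fderiv one_ne_zero).enorm.aemeasurable
            (hψ.continuous.enorm.measurable.pow_const _).aemeasurable
          simp_rw [← ENNReal.rpow_mul] at this
          rwa [hpq.sub_one_mul_conj] at this
  rw [h2] at h1
  set K := C * δ ^ α * P with hK
  have h4 : A ≤ K * B ^ (1 / p) * A ^ (1 / q) := by
    calc A ≤ C * volume S ^ α * (P * (B ^ (1 / p) * A ^ (1 / q))) := h1.trans (by gcongr)
      _ ≤ C * δ ^ α * (P * (B ^ (1 / p) * A ^ (1 / q))) := by gcongr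
      _ = _ := by rw [hK]; ring
  have h5 : A ≤ K ^ p * B := by
    rcases eq_or_ne A 0 with h0 | h0
    · rw [h0]; exact zero_le
    have hne : A ^ (1 / q) ≠ 0 := by
      simp [ENNReal.rpow_eq_zero_iff, h0, hAtop]
    have hne' : A ^ (1 / q) ≠ ∞ := ENNReal.rpow_ne_top_of_nonneg hpq.symm.one_div_nonneg hAtop
    have h6 : A = A ^ (1 / p) * A ^ (1 / q) := by
      rw [← ENNReal.rpow_add _ _ h0 hAtop, one_div, one_div, hpq.inv_add_inv_eq_one,
        ENNReal.rpow_one]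
    have h7 : A ^ (1 / p) ≤ K * B ^ (1 / p) := by
      rw [← ENNReal.mul_le_mul_iff_left hne hne', ← h6]
      exact h4
    have h8 := ENNReal.rpow_le_rpow h7 hp0.le
    rwa [ENNReal.mul_rpow_of_nonneg _ _ hp0.le, one_div, ENNReal.rpow_inv_rpow hp0.ne',
      ENNReal.rpow_inv_rpow hp0.ne'] at h8
  calc M * A ≤ M * (K ^ p * B) := by gcongr
    _ = (M * K ^ p) * B := by ring
    _ ≤ 1 * B := by gcongr
    _ = B := one_mul _

/-! ### Lipschitz functions on the line -/

theorem _root_.LocallyLipschitz.ae_differentiableAt_real {V : Type*} [NormedAddCommGroup V]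
    [NormedSpace ℝ V] [FiniteDimensional ℝ V] {f : ℝ → V} (hf : LocallyLipschitz f) :
    ∀ᵐ s, DifferentiableAt ℝ f s := by
  refine LocallyBoundedVariationOn.ae_differentiableAt fun a b _ _ => ?_
  obtain ⟨K, hK⟩ := hf.locallyLipschitzOn.exists_lipschitzOnWith_of_compact
    (isCompact_Icc (a := a) (b := b))
  rcases le_or_gt a b with hab | hab
  · have := hK.locallyBoundedVariationOn a b ⟨le_rfl, hab⟩ ⟨hab, le_rfl⟩
    rw [Set.inter_self] at this
    rwa [Set.univ_inter]
  · rw [Set.Icc_eq_empty (not_le.2 hab), Set.inter_empty, BoundedVariationOn]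
    simp

open scoped NNReal in
theorem _root_.LocallyLipschitz.lipschitzWith_of_ae_norm_deriv_le {V : Type*}
    [NormedAddCommGroup V] [InnerProductSpace ℝ V] [FiniteDimensional ℝ V] {f : ℝ → V}
    (hf : LocallyLipschitz f) {C : ℝ≥0} (hC : ∀ᵐ s, ‖deriv f s‖ ≤ C) : LipschitzWith C f := by
  refine LipschitzWith.of_dist_le_mul fun b a => ?_
  rw [dist_eq_norm, Real.dist_eq]
  set e := f b - f a with he
  obtain ⟨K, hK⟩ := hf.locallyLipschitzOn.exists_lipschitzOnWith_of_compact
    (isCompact_uIcc (a := a) (b := b))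
  have hlip : LipschitzOnWith (‖innerSL ℝ e‖₊ * K) (fun s => ⟪e, f s⟫) (Set.uIcc a b) :=
    (innerSL ℝ e).lipschitz.comp_lipschitzOnWith hK
  have h1 := hlip.absolutelyContinuousOnInterval.integral_deriv_eq_sub
  have h2 : ‖∫ s in a..b, deriv (fun s => ⟪e, f s⟫) s‖ ≤ (‖e‖ * C) * |b - a| := by
    refine intervalIntegral.norm_integral_le_of_norm_le_const_ae ?_
    filter_upwards [hf.ae_differentiableAt_real, hC] with s hs hs' _
    have hd : HasDerivAt (fun s => ⟪e, f s⟫) ⟪e, deriv f s⟫ s :=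
      (innerSL ℝ e).hasFDerivAt.comp_hasDerivAt s hs.hasDerivAt
    rw [hd.deriv]
    exact (norm_inner_le_norm _ _).trans (by gcongr)
  rw [h1, ← inner_sub_right, ← he, real_inner_self_eq_norm_sq, Real.norm_eq_abs,
    abs_of_nonneg (sq_nonneg _)] at h2
  rcases eq_or_lt_of_le (norm_nonneg e) with h0 | h0
  · rw [← h0]; positivity
  · nlinarith

/-! ### Tubes in an adapted orthonormal frame -/

open scoped NNReal in
/-- `(T, E_1, …, E_n)`, with `T = Γ'`, is a locally Lipschitz orthonormal frame along the
unit-speed curve `Γ`, whose curvature is bounded by `κ`. The normal fields may rotate about `Γ`: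
the rotation of the cross-section of the tube is absorbed in the `E_μ`. -/
structure IsAdaptedFrame {n : ℕ} (Γ : ℝ → Sp (n + 1)) (E : Fin n → ℝ → Sp (n + 1))
    (κ : ℝ≥0) : Prop where
  differentiable : Differentiable ℝ Γ
  lipschitz_deriv : LipschitzWith κ (deriv Γ)
  unit_speed : ∀ s, ‖deriv Γ s‖ = 1
  orthonormal : ∀ s, Orthonormal ℝ (fun μ => E μ s)
  normal : ∀ μ s, ⟪deriv Γ s, E μ s⟫ = 0
  locallyLipschitz : ∀ μ, LocallyLipschitz (E μ)

/-- The map `(s, t) ↦ Γ(s) + t_μ E_μ(s)`. -/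
noncomputable def frameMap {n : ℕ} (Γ : ℝ → Sp (n + 1)) (E : Fin n → ℝ → Sp (n + 1))
    (x : ℝ × Sp n) : Sp (n + 1) :=
  Γ x.1 + ∑ μ, x.2 μ • E μ x.1

theorem norm_sum_smul_of_orthonormal {n m : ℕ} {e : Fin n → Sp m} (he : Orthonormal ℝ e)
    (t : Sp n) : ‖∑ μ, t μ • e μ‖ = ‖t‖ := by
  have h : ‖∑ μ, t μ • e μ‖ ^ 2 = ‖t‖ ^ 2 := by
    rw [← real_inner_self_eq_norm_sq, he.inner_sum, EuclideanSpace.real_norm_sq_eq]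
    simp [sq]
  exact (pow_left_inj₀ (norm_nonneg _) (norm_nonneg _) two_ne_zero).1 h

namespace IsAdaptedFrame

open scoped NNReal

variable {n : ℕ} {Γ : ℝ → Sp (n + 1)} {E : Fin n → ℝ → Sp (n + 1)} {κ : ℝ≥0}

theorem orthonormal_cons (h : IsAdaptedFrame Γ E κ) (s : ℝ) :
    Orthonormal ℝ (Fin.cons (deriv Γ s) (fun μ => E μ s) : Fin (n + 1) → Sp (n + 1)) := by
  rw [orthonormal_iff_ite]
  intro i j
  refine Fin.cases ?_ (fun i => ?_) i <;> refine Fin.cases ?_ (fun j => ?_) j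
  · simp [h.unit_speed]
  · simp [h.normal, (Fin.succ_ne_zero j).symm]
  · rw [real_inner_comm]; simp [h.normal]
  · simp [orthonormal_iff_ite.1 (h.orthonormal s) i j]

/-- The frame `(T, E_1, …, E_n)` at `s`, as an orthonormal basis. -/
noncomputable def basis (h : IsAdaptedFrame Γ E κ) (s : ℝ) :
    OrthonormalBasis (Fin (n + 1)) ℝ (Sp (n + 1)) :=
  (basisOfOrthonormalOfCardEqFinrank (h.orthonormal_cons s) (by simp)).toOrthonormalBasis
    (by rw [coe_basisOfOrthonormalOfCardEqFinrank]; exact h.orthonormal_cons s)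

@[simp] theorem basis_zero (h : IsAdaptedFrame Γ E κ) (s : ℝ) : h.basis s 0 = deriv Γ s := by
  simp [basis]

@[simp] theorem basis_succ (h : IsAdaptedFrame Γ E κ) (s : ℝ) (μ : Fin n) :
    h.basis s μ.succ = E μ s := by
  simp [basis]

theorem expand (h : IsAdaptedFrame Γ E κ) (s : ℝ) (v : Sp (n + 1)) :
    v = ⟪deriv Γ s, v⟫ • deriv Γ s + ∑ μ, ⟪E μ s, v⟫ • E μ s := by
  have := (h.basis s).sum_repr' v
  rw [Fin.sum_univ_succ] at this
  simpa using this.symm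

theorem inner_deriv_sum (h : IsAdaptedFrame Γ E κ) (s : ℝ) (c : Fin n → ℝ) :
    ⟪∑ μ, c μ • E μ s, deriv Γ s⟫ = 0 := by
  rw [sum_inner]
  exact Finset.sum_eq_zero fun μ _ => by rw [real_inner_smul_left, real_inner_comm, h.normal,
    mul_zero]

theorem norm_sum_smul (h : IsAdaptedFrame Γ E κ) (s : ℝ) (t : Sp n) :
    ‖∑ μ, t μ • E μ s‖ = ‖t‖ :=
  norm_sum_smul_of_orthonormal (h.orthonormal s) t

theorem continuous_deriv (h : IsAdaptedFrame Γ E κ) : Continuous (deriv Γ) :=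
  h.lipschitz_deriv.continuous

theorem continuous_frameMap (h : IsAdaptedFrame Γ E κ) : Continuous (frameMap Γ E) := by
  have h1 := h.differentiable.continuous
  have h2 := fun μ => (h.locallyLipschitz μ).continuous
  unfold frameMap
  fun_prop

theorem lipschitzWith_curve (h : IsAdaptedFrame Γ E κ) : LipschitzWith 1 Γ :=
  lipschitzWith_of_nnnorm_deriv_le h.differentiable fun s => by
    rw [← NNReal.coe_le_coe, coe_nnnorm, h.unit_speed, NNReal.coe_one]

/-- The tangential component at `s` of `Γ(s) - L(s', t')` is `s - s'` up to an error controlled by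
the curvature. -/
theorem abs_inner_curve_sub_frameMap_le (h : IsAdaptedFrame Γ E κ) (s s' : ℝ) (t' : Sp n) :
    |⟪Γ s - frameMap Γ E (s', t'), deriv Γ s⟫ - (s - s')|
      ≤ κ * (|s - s'| + ‖t'‖) * |s - s'| := by
  have h1 : ‖(Γ s - s • deriv Γ s) - (Γ s' - s' • deriv Γ s)‖ ≤ (κ * |s - s'|) * ‖s - s'‖ := by
    have hd : ∀ σ, HasDerivAt (fun σ => Γ σ - σ • deriv Γ s) (deriv Γ σ - deriv Γ s) σ :=
      fun σ => by
        have h0 := (h.differentiable σ).hasDerivAt.sub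
          ((hasDerivAt_id σ).smul_const (deriv Γ s))
        rw [one_smul] at h0
        exact h0
    refine Convex.norm_image_sub_le_of_norm_deriv_le (f := fun σ => Γ σ - σ • deriv Γ s)
      (s := Set.uIcc s' s) (fun σ _ => (hd σ).differentiableAt) (fun σ hσ => ?_)
      (convex_uIcc s' s) Set.left_mem_uIcc Set.right_mem_uIcc
    rw [(hd σ).deriv, ← dist_eq_norm]
    refine (h.lipschitz_deriv.dist_le_mul _ _).trans ?_
    gcongr
    rw [Real.dist_eq, abs_sub_comm σ s, ← Real.dist_eq s σ, ← Real.dist_eq s s']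
    have := Set.abs_sub_right_of_mem_uIcc hσ
    rwa [Real.dist_eq, Real.dist_eq]
  have h2 : ⟪Γ s - frameMap Γ E (s', t'), deriv Γ s⟫ - (s - s')
      = ⟪(Γ s - s • deriv Γ s) - (Γ s' - s' • deriv Γ s), deriv Γ s⟫
        - ⟪∑ μ, t' μ • E μ s', deriv Γ s - deriv Γ s'⟫ := by
    have h3 := h.inner_deriv_sum s' t'
    have h4 : ⟪deriv Γ s, deriv Γ s⟫ = 1 := by
      rw [real_inner_self_eq_norm_sq, h.unit_speed, one_pow]
    simp only [frameMap, inner_sub_left, inner_add_left, inner_sub_right, real_inner_smul_left,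
      h3, h4]
    ring
  rw [h2]
  have h5 := (norm_inner_le_norm (𝕜 := ℝ)
    ((Γ s - s • deriv Γ s) - (Γ s' - s' • deriv Γ s)) (deriv Γ s))
  have h6 := (norm_inner_le_norm (𝕜 := ℝ) (∑ μ, t' μ • E μ s') (deriv Γ s - deriv Γ s'))
  have h7 := h.lipschitz_deriv.dist_le_mul s s'
  rw [h.unit_speed, mul_one] at h5
  rw [h.norm_sum_smul] at h6
  rw [dist_eq_norm, Real.dist_eq] at h7
  rw [Real.norm_eq_abs] at h1 h5 h6
  refine (abs_sub _ _).trans ?_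
  nlinarith [norm_nonneg t']

/-- A uniform length scale on which the tangential component of `Γ(s) - L(s', t')` is comparable
to `s - s'`. -/
theorem exists_le_abs_inner (h : IsAdaptedFrame Γ E κ) {a : ℝ} (ha : κ * a < 1) :
    ∃ c > 0, ∃ δ > 0, ∀ s s' : ℝ, ∀ t' : Sp n, ‖t'‖ ≤ a → |s - s'| ≤ δ →
      |⟪Γ s - frameMap Γ E (s', t'), deriv Γ s⟫ - (s - s')| ≤ (1 - c) * |s - s'| := by
  refine ⟨(1 - κ * a) / 2, by linarith, (1 - κ * a) / (2 * (κ + 1)),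
    div_pos (by linarith) (by positivity), fun s s' t' ht hs => ?_⟩
  refine (h.abs_inner_curve_sub_frameMap_le s s' t').trans ?_
  gcongr
  have h1 : (κ : ℝ) * |s - s'| ≤ (1 - κ * a) / 2 := by
    calc (κ : ℝ) * |s - s'| ≤ (κ + 1) * ((1 - κ * a) / (2 * (κ + 1))) := by
          gcongr; linarith
      _ = _ := by field_simp
  have h2 : (κ : ℝ) * ‖t'‖ ≤ κ * a := by gcongr
  nlinarith

/-- The map `L` is open. The parameter `s` of a point near `L(s₀, t₀)` is found by the intermediate
value theorem, as the zero of the tangential component of its difference to `Γ(s)`. -/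
theorem image_mem_nhds (h : IsAdaptedFrame Γ E κ) {z : ℝ × Sp n} (ha : κ * ‖z.2‖ < 1)
    {U : Set (ℝ × Sp n)} (hU : U ∈ 𝓝 z) : frameMap Γ E '' U ∈ 𝓝 (frameMap Γ E z) := by
  obtain ⟨c, hc, δ, hδ, hcδ⟩ := h.exists_le_abs_inner ha
  obtain ⟨s₀, t₀⟩ := z
  set x₀ := frameMap Γ E (s₀, t₀) with hx₀
  let G : ℝ × Sp (n + 1) → ℝ × Sp n :=
    fun y => (y.1, WithLp.toLp 2 fun μ => ⟪E μ y.1, y.2 - Γ y.1⟫)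
  have hG : Continuous G := by
    refine continuous_fst.prodMk ((PiLp.continuous_toLp 2 _).comp (continuous_pi fun μ => ?_))
    exact ((h.locallyLipschitz μ).continuous.comp continuous_fst).inner
      (continuous_snd.sub (h.differentiable.continuous.comp continuous_fst))
  have hG0 : G (s₀, x₀) = (s₀, t₀) := by
    simp only [G, hx₀, frameMap, add_sub_cancel_left]
    refine Prod.ext rfl ?_
    ext μ
    simpa using (h.orthonormal s₀).inner_right_fintype t₀ μ
  have hGU : G ⁻¹' U ∈ 𝓝 (s₀, x₀) := hG.continuousAt (by rwa [hG0])
  rw [nhds_prod_eq] at hGU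
  obtain ⟨A, hA, B, hB, hAB⟩ := mem_prod_iff.1 hGU
  obtain ⟨ε, hε, hεA⟩ := Metric.nhds_basis_closedBall.mem_iff.1 hA
  set r := min ε δ with hr
  have hr0 : 0 < r := lt_min hε hδ
  have hcont : ∀ s, Continuous fun x : Sp (n + 1) => ⟪Γ s - x, deriv Γ s⟫ := fun s =>
    (continuous_const.sub continuous_id).inner continuous_const
  have hp : 0 < ⟪Γ (s₀ + r) - x₀, deriv Γ (s₀ + r)⟫ := by
    have := abs_le.1 (hcδ (s₀ + r) s₀ t₀ le_rfl (by
      rw [add_sub_cancel_left, abs_of_pos hr0]; exact min_le_right _ _))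
    rw [add_sub_cancel_left, abs_of_pos hr0] at this
    nlinarith [this.1]
  have hm : ⟪Γ (s₀ - r) - x₀, deriv Γ (s₀ - r)⟫ < 0 := by
    have hsr : s₀ - r - s₀ = -r := by ring
    have := abs_le.1 (hcδ (s₀ - r) s₀ t₀ le_rfl (by
      rw [hsr, abs_neg, abs_of_pos hr0]; exact min_le_right _ _))
    rw [hsr, abs_neg, abs_of_pos hr0] at this
    nlinarith [this.2]
  filter_upwards [hB, (hcont (s₀ + r)).continuousAt.eventually (lt_mem_nhds hp),
    (hcont (s₀ - r)).continuousAt.eventually (gt_mem_nhds hm)] with x hxB hx1 hx2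
  obtain ⟨s, hs, hs0⟩ := intermediate_value_Icc (a := s₀ - r) (b := s₀ + r) (by linarith)
    (f := fun s => ⟪Γ s - x, deriv Γ s⟫)
    ((h.differentiable.continuous.sub continuous_const).inner h.continuous_deriv).continuousOn
    (Set.mem_Icc.2 ⟨hx2.le, hx1.le⟩)
  refine ⟨G (s, x), ?_, ?_⟩
  · refine hAB (Set.mk_mem_prod (hεA ?_) hxB)
    rw [Metric.mem_closedBall, Real.dist_eq, abs_le]
    have := min_le_left ε δ
    exact ⟨by linarith [hs.1], by linarith [hs.2]⟩
  · have h1 := h.expand s (x - Γ s)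
    have h2 : ⟪deriv Γ s, x - Γ s⟫ = 0 := by
      rw [real_inner_comm, ← neg_sub, inner_neg_left]
      simpa using hs0
    rw [h2, zero_smul, zero_add] at h1
    simp only [frameMap, G]
    rw [← h1]
    abel

/-- The map `L` is locally bi-Lipschitz; here the lower bound. -/
theorem exists_dist_le (h : IsAdaptedFrame Γ E κ) {a : ℝ} (ha : κ * a < 1) (z : ℝ × Sp n) :
    ∃ C : ℝ≥0, ∃ V ∈ 𝓝 z, ∀ y ∈ V, ∀ y' ∈ V, ‖y'.2‖ ≤ a →
      dist y y' ≤ C * dist (frameMap Γ E y) (frameMap Γ E y') := by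
  obtain ⟨c, hc, δ, hδ, hcδ⟩ := h.exists_le_abs_inner ha
  obtain ⟨s₀, t₀⟩ := z
  choose ℓ W hW hℓ using fun μ => h.locallyLipschitz μ s₀
  have hW' : ⋂ μ, W μ ∈ 𝓝 s₀ := (iInter_mem).2 hW
  obtain ⟨ε, hε, hεW⟩ := Metric.mem_nhds_iff.1 hW'
  set C₁ : ℝ := c⁻¹ with hC₁
  have hC₁0 : 0 < C₁ := inv_pos.2 hc
  set C₂ : ℝ := 1 + C₁ + |a| * (∑ μ, (ℓ μ : ℝ)) * C₁ with hC₂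
  have hC₂0 : 0 ≤ C₂ := by positivity
  refine ⟨⟨C₁ + C₂, by positivity⟩, Metric.ball s₀ (min ε (δ / 2)) ×ˢ Set.univ,
    prod_mem_nhds (Metric.ball_mem_nhds _ (lt_min hε (by linarith))) univ_mem, ?_⟩
  rintro ⟨s, t⟩ ⟨hs, -⟩ ⟨s', t'⟩ ⟨hs', -⟩ ht'
  simp only [Metric.mem_ball, lt_min_iff] at hs hs'
  set D := dist (frameMap Γ E (s, t)) (frameMap Γ E (s', t')) with hD
  have hss : |s - s'| ≤ δ := by
    rw [← Real.dist_eq]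
    linarith [dist_triangle_right s s' s₀]
  have h1 : c * |s - s'| ≤ D := by
    have e1 := hcδ s s' t' ht' hss
    have e2 : ⟪Γ s - frameMap Γ E (s', t'), deriv Γ s⟫
        = ⟪frameMap Γ E (s, t) - frameMap Γ E (s', t'), deriv Γ s⟫ := by
      rw [frameMap, frameMap, add_sub_right_comm, inner_add_left, h.inner_deriv_sum, add_zero]
    have e3 := norm_inner_le_norm (𝕜 := ℝ)
      (frameMap Γ E (s, t) - frameMap Γ E (s', t')) (deriv Γ s)
    rw [h.unit_speed, mul_one, ← e2, Real.norm_eq_abs, ← dist_eq_norm] at e3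
    have e4 := abs_sub_abs_le_abs_sub (s - s') ⟪Γ s - frameMap Γ E (s', t'), deriv Γ s⟫
    rw [abs_sub_comm (s - s')] at e4
    linarith
  have h2 : |s - s'| ≤ C₁ * D := by
    rw [hC₁, ← div_eq_inv_mul, le_div_iff₀ hc, mul_comm]
    exact h1
  have h3 : ‖t - t'‖ ≤ C₂ * D := by
    have e1 : ∑ μ, (t - t') μ • E μ s = (frameMap Γ E (s, t) - frameMap Γ E (s', t'))
        - (Γ s - Γ s') - ∑ μ, t' μ • (E μ s - E μ s') := by
      simp only [frameMap, PiLp.sub_apply, sub_smul, smul_sub, Finset.sum_sub_distrib]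
      abel
    have e2 : ‖∑ μ, t' μ • (E μ s - E μ s')‖ ≤ |a| * (∑ μ, (ℓ μ : ℝ)) * |s - s'| := by
      rw [mul_assoc, Finset.sum_mul, Finset.mul_sum]
      refine norm_sum_le_of_le _ fun μ _ => ?_
      rw [norm_smul, ← dist_eq_norm]
      gcongr
      · exact (PiLp.norm_apply_le t' μ).trans (ht'.trans (le_abs_self a))
      · have hw := Set.mem_iInter.1 (hεW (Metric.mem_ball.2 hs.1)) μ
        have hw' := Set.mem_iInter.1 (hεW (Metric.mem_ball.2 hs'.1)) μ
        simpa [Real.dist_eq] using (hℓ μ).dist_le_mul s hw s' hw'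
    have e3 := h.lipschitzWith_curve.dist_le_mul s s'
    rw [NNReal.coe_one, one_mul, Real.dist_eq, dist_eq_norm] at e3
    rw [← h.norm_sum_smul s, e1]
    calc _ ≤ D + |s - s'| + |a| * (∑ μ, (ℓ μ : ℝ)) * |s - s'| := by
          refine (norm_sub_le _ _).trans (add_le_add ((norm_sub_le _ _).trans ?_) e2)
          rw [← dist_eq_norm]
          gcongr
      _ ≤ D + C₁ * D + |a| * (∑ μ, (ℓ μ : ℝ)) * (C₁ * D) := by gcongr
      _ = C₂ * D := by rw [hC₂]; ring
  have hD0 : 0 ≤ D := dist_nonneg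
  change dist (s, t) (s', t') ≤ (C₁ + C₂) * D
  rw [Prod.dist_eq, max_le_iff]
  refine ⟨?_, ?_⟩
  · change dist s s' ≤ _
    rw [Real.dist_eq]; nlinarith
  · change dist t t' ≤ _
    rw [dist_eq_norm]; nlinarith

end IsAdaptedFrame

/-! ### Change of variables in the tube -/

theorem _root_.LocallyLipschitz.smul_fun {X V : Type*} [PseudoEMetricSpace X]
    [NormedAddCommGroup V] [NormedSpace ℝ V] {f : X → ℝ} {g : X → V} (hf : LocallyLipschitz f)
    (hg : LocallyLipschitz g) : LocallyLipschitz fun x => f x • g x := by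
  have h : LocallyLipschitz fun y : ℝ × V => y.1 • y.2 :=
    (contDiff_fst.smul contDiff_snd : ContDiff ℝ 1 fun y : ℝ × V => y.1 • y.2).locallyLipschitz
  exact h.comp (hf.prodMk hg)

theorem _root_.LocallyLipschitz.sum_fun {X V ι : Type*} [PseudoEMetricSpace X]
    [NormedAddCommGroup V] (s : Finset ι) {f : ι → X → V} (hf : ∀ i, LocallyLipschitz (f i)) :
    LocallyLipschitz fun x => ∑ i ∈ s, f i x := by
  classical
  induction s using Finset.induction_on with
  | empty => simpa using LocallyLipschitz.const (α := X) (0 : V)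
  | insert i s hi ih => simpa [Finset.sum_insert hi] using (hf i).add ih

/-- A locally Lipschitz map of `ℝ^m` into itself maps null sets to null sets. -/
theorem _root_.LocallyLipschitz.volume_image_eq_zero {m : ℕ} {f : Sp m → Sp m}
    (hf : LocallyLipschitz f) {s : Set (Sp m)} (hs : volume s = 0) : volume (f '' s) = 0 := by
  have hac : (volume : Measure (Sp m)) ≪ Measure.hausdorffMeasure m :=
    Measure.absolutelyContinuous_isAddHaarMeasure _ _
  have hac' : (Measure.hausdorffMeasure m : Measure (Sp m)) ≪ volume :=
    Measure.absolutelyContinuous_isAddHaarMeasure _ _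
  refine hac ?_
  have hcov : f '' s = ⋃ k : ℕ, f '' (s ∩ Metric.closedBall 0 k) := by
    rw [← Set.image_iUnion, ← Set.inter_iUnion, Metric.iUnion_closedBall_nat, Set.inter_univ]
  rw [hcov, measure_iUnion_null_iff]
  intro k
  obtain ⟨K, hK⟩ := hf.locallyLipschitzOn.exists_lipschitzOnWith_of_compact
    (isCompact_closedBall (0 : Sp m) k)
  have h1 := (hK.mono (Set.inter_subset_right (s := s))).hausdorffMeasure_image_le
    (d := m) (Nat.cast_nonneg m)
  rw [hac' (measure_mono_null Set.inter_subset_left hs), mul_zero] at h1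
  exact le_antisymm h1 zero_le

/-- The identification `ℝ × ℝ^n ≃ ℝ^(n+1)`. -/
noncomputable def consEquiv (n : ℕ) : (ℝ × Sp n) ≃L[ℝ] Sp (n + 1) :=
  LinearEquiv.toContinuousLinearEquiv
    { toFun := fun x => WithLp.toLp 2 (Fin.cons x.1 x.2.ofLp)
      invFun := fun y => (y 0, WithLp.toLp 2 fun i => y i.succ)
      map_add' := fun x y => by
        ext i; refine Fin.cases ?_ (fun i => ?_) i <;> simp
      map_smul' := fun c x => by
        ext i; refine Fin.cases ?_ (fun i => ?_) i <;> simp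
      left_inv := fun x => by ext <;> simp
      right_inv := fun y => by
        ext i; refine Fin.cases ?_ (fun i => ?_) i <;> simp }

theorem consEquiv_apply {n : ℕ} (x : ℝ × Sp n) :
    consEquiv n x = WithLp.toLp 2 (Fin.cons x.1 x.2.ofLp) := rfl

theorem consEquiv_symm_apply {n : ℕ} (y : Sp (n + 1)) :
    (consEquiv n).symm y = (y 0, WithLp.toLp 2 fun i => y i.succ) := rfl

theorem measurePreserving_consEquiv (n : ℕ) : MeasurePreserving (consEquiv n) := by
  have h1 : MeasurePreserving (Prod.map id WithLp.ofLp : ℝ × Sp n → ℝ × (Fin n → ℝ)) :=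
    (MeasurePreserving.id volume).prod (PiLp.volume_preserving_ofLp (Fin n))
  have h2 := (volume_preserving_piFinSuccAbove (fun _ : Fin (n + 1) => ℝ) 0).symm
  have h3 := PiLp.volume_preserving_toLp (Fin (n + 1))
  convert (h3.comp h2).comp h1 using 1
  funext x
  simp only [consEquiv_apply, Function.comp_apply, Prod.map]
  congr 1
  simp [MeasurableEquiv.piFinSuccAbove]
  rfl

/-- The Jacobian `1 - t_μ ⟨E_μ, T'⟩` of the map `L`. -/
noncomputable def frameJac {n : ℕ} (Γ : ℝ → Sp (n + 1)) (E : Fin n → ℝ → Sp (n + 1))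
    (s : ℝ) (t : Sp n) : ℝ :=
  1 - ∑ μ, t μ * ⟪E μ s, deriv (deriv Γ) s⟫

/-- The coefficients `t_α ⟨E_μ, E_α'⟩`, which describe the rotation of the frame about `Γ`. -/
noncomputable def frameTwist {n : ℕ} (E : Fin n → ℝ → Sp (n + 1)) (μ : Fin n)
    (s : ℝ) (t : Sp n) : ℝ :=
  ∑ α, t α * ⟪E μ s, deriv (E α) s⟫

/-- The derivative of the map `L`. -/
noncomputable def frameDeriv {n : ℕ} (Γ : ℝ → Sp (n + 1)) (E : Fin n → ℝ → Sp (n + 1))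
    (x : ℝ × Sp n) : (ℝ × Sp n) →L[ℝ] Sp (n + 1) :=
  (ContinuousLinearMap.fst ℝ ℝ (Sp n)).smulRight (deriv Γ x.1 + ∑ μ, x.2 μ • deriv (E μ) x.1)
    + ∑ μ, ((EuclideanSpace.proj μ).comp (ContinuousLinearMap.snd ℝ ℝ (Sp n))).smulRight (E μ x.1)

theorem frameDeriv_apply {n : ℕ} (Γ : ℝ → Sp (n + 1)) (E : Fin n → ℝ → Sp (n + 1))
    (x y : ℝ × Sp n) :
    frameDeriv Γ E x y = y.1 • (deriv Γ x.1 + ∑ μ, x.2 μ • deriv (E μ) x.1)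
      + ∑ μ, y.2 μ • E μ x.1 := by
  simp [frameDeriv]

/-- The parameters at which the frame is differentiable. -/
def frameRegular {n : ℕ} (Γ : ℝ → Sp (n + 1)) (E : Fin n → ℝ → Sp (n + 1)) : Set ℝ :=
  {s | DifferentiableAt ℝ (deriv Γ) s} ∩ ⋂ μ, {s | DifferentiableAt ℝ (E μ) s}

namespace IsAdaptedFrame

open scoped NNReal

variable {n : ℕ} {Γ : ℝ → Sp (n + 1)} {E : Fin n → ℝ → Sp (n + 1)} {κ : ℝ≥0}

theorem measurableSet_frameRegular : MeasurableSet (frameRegular Γ E) :=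
  (measurableSet_of_differentiableAt ℝ _).inter
    (MeasurableSet.iInter fun _ => measurableSet_of_differentiableAt ℝ _)

theorem ae_mem_frameRegular (h : IsAdaptedFrame Γ E κ) : ∀ᵐ s, s ∈ frameRegular Γ E := by
  have h1 := h.lipschitz_deriv.locallyLipschitz.ae_differentiableAt_real
  have h2 := ae_all_iff.2 fun μ => (h.locallyLipschitz μ).ae_differentiableAt_real
  filter_upwards [h1, h2] with s hs hs'
  exact ⟨hs, Set.mem_iInter.2 hs'⟩

theorem locallyLipschitz_frameMap (h : IsAdaptedFrame Γ E κ) :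
    LocallyLipschitz (frameMap Γ E) := by
  have hfst : LocallyLipschitz (Prod.fst : ℝ × Sp n → ℝ) := LipschitzWith.prod_fst.locallyLipschitz
  refine (h.lipschitzWith_curve.locallyLipschitz.comp hfst).add
    (LocallyLipschitz.sum_fun _ fun μ => LocallyLipschitz.smul_fun ?_
      ((h.locallyLipschitz μ).comp hfst))
  exact ((EuclideanSpace.proj (𝕜 := ℝ) μ).comp
    (ContinuousLinearMap.snd ℝ ℝ (Sp n))).lipschitz.locallyLipschitz

theorem hasFDerivAt_frameMap (h : IsAdaptedFrame Γ E κ) {s : ℝ} (hs : s ∈ frameRegular Γ E)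
    (t : Sp n) : HasFDerivAt (frameMap Γ E) (frameDeriv Γ E (s, t)) (s, t) := by
  have h0 : ∀ {f : ℝ → Sp (n + 1)}, DifferentiableAt ℝ f s →
      HasFDerivAt (fun x : ℝ × Sp n => f x.1)
        ((ContinuousLinearMap.fst ℝ ℝ (Sp n)).smulRight (deriv f s)) (s, t) := fun hf => by
    refine (HasFDerivAt.comp (s, t) hf.hasDerivAt.hasFDerivAt hasFDerivAt_fst).congr_fderiv ?_
    ext y <;> simp
  have h1 := h0 (h.differentiable s)
  have h2 : ∀ μ, HasFDerivAt (fun x : ℝ × Sp n => x.2 μ • E μ x.1)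
      (t μ • (ContinuousLinearMap.fst ℝ ℝ (Sp n)).smulRight (deriv (E μ) s)
        + ((EuclideanSpace.proj μ).comp (ContinuousLinearMap.snd ℝ ℝ (Sp n))).smulRight (E μ s))
      (s, t) := fun μ => by
    have e1 := h0 (Set.mem_iInter.1 hs.2 μ)
    have e2 : HasFDerivAt (fun x : ℝ × Sp n => x.2 μ)
        ((EuclideanSpace.proj (𝕜 := ℝ) μ).comp (ContinuousLinearMap.snd ℝ ℝ (Sp n))) (s, t) :=
      ((EuclideanSpace.proj (𝕜 := ℝ) μ).comp (ContinuousLinearMap.snd ℝ ℝ (Sp n))).hasFDerivAt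
    exact e2.smul e1
  have h3 := h1.add (HasFDerivAt.fun_sum (u := Finset.univ) fun μ _ => h2 μ)
  refine h3.congr_fderiv ?_
  ext y
  · simp [frameDeriv_apply]
  · simp [frameDeriv_apply]

/-- In the frame, `∂_s L = h T + f_μ E_μ`. -/
theorem deriv_add_sum_eq (h : IsAdaptedFrame Γ E κ) {s : ℝ} (hs : s ∈ frameRegular Γ E)
    (t : Sp n) : deriv Γ s + ∑ μ, t μ • deriv (E μ) s
      = frameJac Γ E s t • deriv Γ s + ∑ μ, frameTwist E μ s t • E μ s := by
  have h1 : ∀ μ, ⟪deriv Γ s, deriv (E μ) s⟫ = - ⟪E μ s, deriv (deriv Γ) s⟫ := by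
    intro μ
    have e1 := (hs.1 : DifferentiableAt ℝ (deriv Γ) s).hasDerivAt.inner ℝ
      (Set.mem_iInter.1 hs.2 μ : DifferentiableAt ℝ (E μ) s).hasDerivAt
    have e2 : (fun σ => ⟪deriv Γ σ, E μ σ⟫) = fun _ => (0 : ℝ) := funext fun σ => h.normal μ σ
    rw [e2] at e1
    have e3 := e1.unique (hasDerivAt_const s 0)
    rw [real_inner_comm (E μ s)] at e3
    linarith
  have h2 := h.expand s (deriv Γ s + ∑ μ, t μ • deriv (E μ) s)
  have h3 : ⟪deriv Γ s, deriv Γ s + ∑ μ, t μ • deriv (E μ) s⟫ = frameJac Γ E s t := by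
    rw [inner_add_right, real_inner_self_eq_norm_sq, h.unit_speed, inner_sum, frameJac]
    simp [real_inner_smul_right, h1, Finset.sum_neg_distrib, sub_eq_add_neg]
  have h4 : ∀ μ, ⟪E μ s, deriv Γ s + ∑ μ, t μ • deriv (E μ) s⟫ = frameTwist E μ s t := by
    intro μ
    rw [inner_add_right, real_inner_comm, h.normal, inner_sum, frameTwist, zero_add]
    simp [real_inner_smul_right]
  rw [h2, h3]
  simp_rw [h4]

theorem abs_det_frameDeriv (h : IsAdaptedFrame Γ E κ) {s : ℝ} (hs : s ∈ frameRegular Γ E)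
    (t : Sp n) :
    |((frameDeriv Γ E (s, t)).comp ((consEquiv n).symm : Sp (n + 1) →L[ℝ] ℝ × Sp n)).det|
      = |frameJac Γ E s t| := by
  set A := (frameDeriv Γ E (s, t)).comp ((consEquiv n).symm : Sp (n + 1) →L[ℝ] ℝ × Sp n)
  let c := EuclideanSpace.basisFun (Fin (n + 1)) ℝ
  let b := h.basis s
  have h0 : A (c 0) = frameJac Γ E s t • b 0 + ∑ μ, frameTwist E μ s t • b μ.succ := by
    simp only [A, c, b, ContinuousLinearMap.comp_apply, ContinuousLinearEquiv.coe_coe,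
      consEquiv_symm_apply, frameDeriv_apply, basis_zero, basis_succ, ← h.deriv_add_sum_eq hs]
    simp
  have hsucc : ∀ μ : Fin n, A (c μ.succ) = b μ.succ := by
    intro μ
    simp only [A, c, b, ContinuousLinearMap.comp_apply, ContinuousLinearEquiv.coe_coe,
      consEquiv_symm_apply, frameDeriv_apply, basis_succ]
    simp [(Fin.succ_ne_zero μ).symm]
  have hb : ∀ i j, ⟪b i, b j⟫ = if i = j then 1 else 0 := orthonormal_iff_ite.1 b.orthonormal
  have hM : ∀ i j, LinearMap.toMatrix c.toBasis b.toBasis (A : Sp (n + 1) →ₗ[ℝ] Sp (n + 1)) i j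
      = ⟪b i, A (c j)⟫ := by
    intro i j
    rw [LinearMap.toMatrix_apply]
    simp [OrthonormalBasis.repr_apply_apply]
  have hdet : (LinearMap.toMatrix c.toBasis b.toBasis
      (A : Sp (n + 1) →ₗ[ℝ] Sp (n + 1))).det = frameJac Γ E s t := by
    rw [Matrix.det_of_isLowerTriangular]
    · rw [Fin.prod_univ_succ]
      simp only [hM, h0, hsucc, inner_add_right, real_inner_smul_right, inner_sum, hb]
      simp [(Fin.succ_ne_zero _).symm]
    · intro i j hij
      have hij' : i < j := hij
      rw [hM]
      obtain ⟨μ, rfl⟩ := Fin.exists_succ_eq.2 (Fin.ne_zero_of_lt hij')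
      rw [hsucc, hb, if_neg hij'.ne]
  have hdet' := congrArg Matrix.det
    (basis_toMatrix_mul_linearMap_toMatrix c.toBasis b.toBasis c.toBasis
      (A : Sp (n + 1) →ₗ[ℝ] Sp (n + 1)))
  rw [Matrix.det_mul, hdet, LinearMap.det_toMatrix] at hdet'
  have h1 : |(b.toBasis.toMatrix c.toBasis).det| = 1 := by
    rcases b.det_to_matrix_orthonormalBasis_real c with h | h <;>
    · simp only [Module.Basis.det_apply] at h
      rw [OrthonormalBasis.coe_toBasis, h]
      simp
  have h2 : A.det = LinearMap.det (A : Sp (n + 1) →ₗ[ℝ] Sp (n + 1)) := rfl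
  rw [h2, ← hdet', abs_mul, h1, one_mul]

theorem measurable_frameJac (h : IsAdaptedFrame Γ E κ) :
    Measurable fun x : ℝ × Sp n => frameJac Γ E x.1 x.2 := by
  unfold frameJac
  refine measurable_const.sub (Finset.measurable_sum _ fun μ _ => Measurable.mul ?_ ?_)
  · exact ((EuclideanSpace.proj (𝕜 := ℝ) μ).continuous.comp continuous_snd).measurable
  · exact (((h.locallyLipschitz μ).continuous.measurable).inner
      (measurable_deriv (deriv Γ))).comp measurable_fst

/-- Integration over the tube in the coordinates `(s, t)`. -/
theorem lintegral_image_frameMap (h : IsAdaptedFrame Γ E κ) {ω : Set (Sp n)}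
    (hω : MeasurableSet ω) (hinj : Set.InjOn (frameMap Γ E) (Set.univ ×ˢ ω))
    {g : Sp (n + 1) → ℝ≥0∞} (hg : Measurable g) :
    ∫⁻ x in frameMap Γ E '' (Set.univ ×ˢ ω), g x
      = ∫⁻ s, ∫⁻ t in ω, ENNReal.ofReal |frameJac Γ E s t| * g (frameMap Γ E (s, t)) := by
  set S := frameRegular Γ E with hS
  have hSm : MeasurableSet S := measurableSet_frameRegular
  have hS0 : volume Sᶜ = 0 := h.ae_mem_frameRegular
  let e := consEquiv n
  have he := measurePreserving_consEquiv n
  have hem : MeasurableEmbedding e := e.toHomeomorph.measurableEmbedding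
  let F : Sp (n + 1) → Sp (n + 1) := frameMap Γ E ∘ e.symm
  have hFl : LocallyLipschitz F :=
    h.locallyLipschitz_frameMap.comp e.symm.lipschitz.locallyLipschitz
  have hFe : ∀ D : Set (ℝ × Sp n), F '' (e '' D) = frameMap Γ E '' D := by
    intro D
    rw [Set.image_image]
    simp [F]
  -- The change of variables applies over the differentiability points `S` of the frame only; the
  -- rest has null image because the map is locally Lipschitz between spaces of equal dimension.
  have hnull : volume (frameMap Γ E '' (Sᶜ ×ˢ Set.univ)) = 0 := by
    rw [← hFe]
    refine hFl.volume_image_eq_zero ?_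
    rw [← he.measure_preimage_emb hem, Set.preimage_image_eq _ e.injective,
      Measure.volume_eq_prod, Measure.prod_prod, hS0, zero_mul]
  have hae : frameMap Γ E '' (S ×ˢ ω) =ᵐ[volume] frameMap Γ E '' (Set.univ ×ˢ ω) := by
    refine (LE.le.eventuallyLE
      (Set.image_mono (Set.prod_mono (Set.subset_univ _) le_rfl))).antisymm ?_
    refine (ae_le_set).2 (measure_mono_null ?_ hnull)
    rintro _ ⟨⟨⟨s, t⟩, ht, rfl⟩, h2⟩
    refine ⟨(s, t), ⟨fun hs => h2 ⟨(s, t), ⟨hs, ht.2⟩, rfl⟩, trivial⟩, rfl⟩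
  have hD : MeasurableSet (S ×ˢ ω) := hSm.prod hω
  rw [← setLIntegral_congr hae, ← hFe]
  rw [lintegral_image_eq_lintegral_abs_det_fderiv_mul volume (hem.measurableSet_image.2 hD)
    (f' := fun y => (frameDeriv Γ E (e.symm y)).comp (e.symm : Sp (n + 1) →L[ℝ] ℝ × Sp n))]
  · rw [← he.setLIntegral_comp_emb hem]
    have h1 : ∫⁻ z in S ×ˢ ω, ENNReal.ofReal
          |((frameDeriv Γ E (e.symm (e z))).comp (e.symm : Sp (n + 1) →L[ℝ] ℝ × Sp n)).det|
            * g (F (e z))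
        = ∫⁻ z in S ×ˢ ω, ENNReal.ofReal |frameJac Γ E z.1 z.2| * g (frameMap Γ E z) := by
      refine setLIntegral_congr_fun hD fun z hz => ?_
      beta_reduce
      rw [e.symm_apply_apply, h.abs_det_frameDeriv hz.1 z.2]
      simp [F]
    rw [h1, Measure.volume_eq_prod, ← Measure.prod_restrict, lintegral_prod]
    · rw [Measure.restrict_eq_self_of_ae_mem h.ae_mem_frameRegular]
    · exact (((h.measurable_frameJac).abs.ennreal_ofReal).mul
        (hg.comp h.continuous_frameMap.measurable)).aemeasurable
  · rintro _ ⟨⟨s, t⟩, hz, rfl⟩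
    rw [e.symm_apply_apply]
    have h1 : HasFDerivAt (frameMap Γ E) (frameDeriv Γ E (s, t)) (e.symm (e (s, t))) := by
      rw [e.symm_apply_apply]
      exact h.hasFDerivAt_frameMap hz.1 t
    exact (h1.comp _ e.symm.hasFDerivAt).hasFDerivWithinAt
  · rintro _ ⟨z, hz, rfl⟩ _ ⟨z', hz', rfl⟩ hzz
    simp only [F, Function.comp_apply, e.symm_apply_apply] at hzz
    rw [hinj ⟨trivial, hz.2⟩ ⟨trivial, hz'.2⟩ hzz]

end IsAdaptedFrame

/-! ### The tube as a homeomorphic image of the straight tube -/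

namespace IsAdaptedFrame

open scoped NNReal

variable {n : ℕ} {Γ : ℝ → Sp (n + 1)} {E : Fin n → ℝ → Sp (n + 1)} {κ : ℝ≥0}
  {ω : Set (Sp n)} {a : ℝ}

theorem mul_norm_lt_one (ha : ∀ t ∈ ω, ‖t‖ ≤ a) (hκ : κ * a < 1) {t : Sp n} (ht : t ∈ ω) :
    κ * ‖t‖ < 1 :=
  lt_of_le_of_lt (mul_le_mul_of_nonneg_left (ha t ht) κ.2) hκ

theorem isOpen_image_frameMap (h : IsAdaptedFrame Γ E κ) (hω : IsOpen ω)
    (ha : ∀ t ∈ ω, ‖t‖ ≤ a) (hκ : κ * a < 1) :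
    IsOpen (frameMap Γ E '' (Set.univ ×ˢ ω)) := by
  rw [isOpen_iff_mem_nhds]
  rintro _ ⟨z, hz, rfl⟩
  exact h.image_mem_nhds (mul_norm_lt_one ha hκ hz.2) ((isOpen_univ.prod hω).mem_nhds hz)

/-- The inverse of `L` on the tube is locally Lipschitz. -/
theorem exists_locallyLipschitzOn_inverse (h : IsAdaptedFrame Γ E κ) (hω : IsOpen ω)
    (ha : ∀ t ∈ ω, ‖t‖ ≤ a) (hκ : κ * a < 1)
    (hinj : Set.InjOn (frameMap Γ E) (Set.univ ×ˢ ω)) :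
    ∃ G : Sp (n + 1) → ℝ × Sp n, LocallyLipschitzOn (frameMap Γ E '' (Set.univ ×ˢ ω)) G ∧
      (∀ z ∈ Set.univ ×ˢ ω, G (frameMap Γ E z) = z) ∧
      ∀ x ∈ frameMap Γ E '' (Set.univ ×ˢ ω), G x ∈ Set.univ ×ˢ ω ∧ frameMap Γ E (G x) = x := by
  have : Nonempty (ℝ × Sp n) := ⟨0⟩
  let G := Function.invFunOn (frameMap Γ E) (Set.univ ×ˢ ω)
  have hG1 : ∀ z ∈ Set.univ ×ˢ ω, G (frameMap Γ E z) = z := fun z hz =>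
    hinj.leftInvOn_invFunOn hz
  have hG2 : ∀ x ∈ frameMap Γ E '' (Set.univ ×ˢ ω),
      G x ∈ Set.univ ×ˢ ω ∧ frameMap Γ E (G x) = x := fun x hx =>
    ⟨Function.invFunOn_mem hx, Function.invFunOn_eq hx⟩
  refine ⟨G, ?_, hG1, hG2⟩
  rintro _ ⟨z, hz, rfl⟩
  obtain ⟨C, V, hV, hC⟩ := h.exists_dist_le hκ z
  refine ⟨C, frameMap Γ E '' (V ∩ Set.univ ×ˢ ω), mem_nhdsWithin_of_mem_nhds
    (h.image_mem_nhds (mul_norm_lt_one ha hκ hz.2)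
      (inter_mem hV ((isOpen_univ.prod hω).mem_nhds hz))), ?_⟩
  refine LipschitzOnWith.of_dist_le_mul ?_
  rintro _ ⟨y, hy, rfl⟩ _ ⟨y', hy', rfl⟩
  rw [hG1 y hy.2, hG1 y' hy'.2]
  exact hC y hy.1 y' hy'.1 (ha _ hy'.2.2)

theorem isCompact_preimage (h : IsAdaptedFrame Γ E κ) (hω : IsOpen ω)
    (ha : ∀ t ∈ ω, ‖t‖ ≤ a) (hκ : κ * a < 1)
    (hinj : Set.InjOn (frameMap Γ E) (Set.univ ×ˢ ω)) {K : Set (Sp (n + 1))} (hK : IsCompact K)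
    (hKΩ : K ⊆ frameMap Γ E '' (Set.univ ×ˢ ω)) :
    IsCompact (Set.univ ×ˢ ω ∩ frameMap Γ E ⁻¹' K) := by
  obtain ⟨G, hGl, hG1, hG2⟩ := h.exists_locallyLipschitzOn_inverse hω ha hκ hinj
  have : Set.univ ×ˢ ω ∩ frameMap Γ E ⁻¹' K = G '' K := by
    ext z
    constructor
    · rintro ⟨hz, hzK⟩
      exact ⟨_, hzK, hG1 z hz⟩
    · rintro ⟨x, hx, rfl⟩
      refine ⟨(hG2 x (hKΩ hx)).1, ?_⟩
      rw [Set.mem_preimage, (hG2 x (hKΩ hx)).2]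
      exact hx
  rw [this]
  exact hK.image_of_continuousOn (hGl.continuousOn.mono hKΩ)

/-- The Jacobian is close to one where the curvature is small. -/
theorem abs_frameJac_sub_one_le (h : IsAdaptedFrame Γ E κ) (s : ℝ) (t : Sp n) :
    |frameJac Γ E s t - 1| ≤ ‖t‖ * curvature Γ s := by
  have : frameJac Γ E s t - 1 = -⟪∑ μ, t μ • E μ s, deriv (deriv Γ) s⟫ := by
    rw [frameJac, sum_inner]
    simp [real_inner_smul_left]
  rw [this, abs_neg, ← h.norm_sum_smul s t]
  exact abs_real_inner_le_norm _ _

theorem curvature_le (h : IsAdaptedFrame Γ E κ) (s : ℝ) : curvature Γ s ≤ κ :=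
  norm_deriv_le_of_lipschitz h.lipschitz_deriv

/-! ### The lower bound -/

/-- The cross-sections of a test function of the tube are test functions of the cross-section of
the tube. -/
theorem isTestFunction_slice (h : IsAdaptedFrame Γ E κ) (hω : IsOpen ω)
    (ha : ∀ t ∈ ω, ‖t‖ ≤ a) (hκ : κ * a < 1)
    (hinj : Set.InjOn (frameMap Γ E) (Set.univ ×ˢ ω)) {u : Sp (n + 1) → ℝ}
    (hu : IsTestFunction (frameMap Γ E '' (Set.univ ×ˢ ω)) u) (s : ℝ) :
    IsTestFunction {t ∈ ω | frameMap Γ E (s, t) ∈ tsupport u}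
      (ω.indicator fun t => u (frameMap Γ E (s, t))) := by
  set P := {t ∈ ω | frameMap Γ E (s, t) ∈ tsupport u} with hP
  have hPc : IsCompact P := by
    have h1 := h.isCompact_preimage hω ha hκ hinj hu.compact.isCompact hu.support_subset
    have h2 := (h1.inter_right (isClosed_singleton.preimage continuous_fst :
      IsClosed (Prod.fst ⁻¹' {s} : Set (ℝ × Sp n)))).image continuous_snd
    convert h2 using 1
    ext t
    constructor
    · rintro ⟨h3, h4⟩
      exact ⟨(s, t), ⟨⟨⟨trivial, h3⟩, h4⟩, rfl⟩, rfl⟩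
    · rintro ⟨⟨s', t'⟩, ⟨⟨⟨-, h3⟩, h4⟩, h5⟩, rfl⟩
      obtain rfl : s' = s := h5
      exact ⟨h3, h4⟩
  have hzero : ∀ t ∉ P, ω.indicator (fun t => u (frameMap Γ E (s, t))) t = 0 := by
    intro t ht
    by_cases htω : t ∈ ω
    · rw [Set.indicator_of_mem htω]
      exact image_eq_zero_of_notMem_tsupport fun h' => ht ⟨htω, h'⟩
    · exact Set.indicator_of_notMem htω _
  have hsupp : tsupport (ω.indicator fun t => u (frameMap Γ E (s, t))) ⊆ P :=
    closure_minimal (fun t ht => by_contra fun h' => ht (hzero t h')) hPc.isClosed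
  refine ⟨?_, hPc.of_isClosed_subset (isClosed_tsupport _) hsupp, hsupp⟩
  rw [contDiff_iff_contDiffAt]
  intro t
  by_cases ht : t ∈ ω
  · have h1 : ContDiff ℝ (⊤ : ℕ∞) fun t : Sp n => u (frameMap Γ E (s, t)) := by
      refine hu.smooth.comp ?_
      change ContDiff ℝ _ fun t : Sp n => Γ s + ∑ μ, t μ • E μ s
      fun_prop
    refine h1.contDiffAt.congr_of_eventuallyEq ?_
    filter_upwards [hω.mem_nhds ht] with t' ht' using Set.indicator_of_mem ht' _
  · refine (contDiffAt_const (c := (0 : ℝ))).congr_of_eventuallyEq ?_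
    filter_upwards [hPc.isClosed.isOpen_compl.mem_nhds (fun h' : t ∈ P => ht h'.1)] with t' ht'
      using hzero t' ht'

theorem norm_fderiv_slice_le (h : IsAdaptedFrame Γ E κ) (hω : IsOpen ω) {u : Sp (n + 1) → ℝ}
    (hu : Differentiable ℝ u) (s : ℝ) {t : Sp n} (ht : t ∈ ω) :
    ‖fderiv ℝ (ω.indicator fun t => u (frameMap Γ E (s, t))) t‖
      ≤ ‖fderiv ℝ u (frameMap Γ E (s, t))‖ := by
  let J : Sp n →L[ℝ] Sp (n + 1) := ∑ μ, (EuclideanSpace.proj (𝕜 := ℝ) μ).smulRight (E μ s)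
  have hJ : ∀ τ, J τ = ∑ μ, τ μ • E μ s := fun τ => by simp [J]
  have h1 : HasFDerivAt (fun t => frameMap Γ E (s, t)) J t := by
    have e : (fun t => frameMap Γ E (s, t)) = fun t => Γ s + J t := by
      funext τ; rw [hJ]; rfl
    rw [e]
    exact J.hasFDerivAt.const_add _
  have h2 : HasFDerivAt (ω.indicator fun t => u (frameMap Γ E (s, t)))
      ((fderiv ℝ u (frameMap Γ E (s, t))).comp J) t := by
    refine ((hu _).hasFDerivAt.comp t h1).congr_of_eventuallyEq ?_
    filter_upwards [hω.mem_nhds ht] with t' ht' using Set.indicator_of_mem ht' _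
  rw [h2.fderiv]
  have h3 : ‖J‖ ≤ 1 := J.opNorm_le_bound zero_le_one fun τ => by
    rw [hJ, h.norm_sum_smul, one_mul]
  calc _ ≤ ‖fderiv ℝ u (frameMap Γ E (s, t))‖ * ‖J‖ := ContinuousLinearMap.opNorm_comp_le _ _
    _ ≤ _ := mul_le_of_le_one_right (norm_nonneg _) h3

/-- The lower bound on one cross-section of the tube, where the Jacobian is between `1 - b` and
`1 + b` and the Rayleigh quotient of the section of `u` is at least `X`. -/
theorem slice_lower_bound (h : IsAdaptedFrame Γ E κ) (hω : IsOpen ω)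
    (ha : ∀ t ∈ ω, ‖t‖ ≤ a) (hκ : κ * a < 1)
    (hinj : Set.InjOn (frameMap Γ E) (Set.univ ×ˢ ω)) {u : Sp (n + 1) → ℝ}
    (hu : IsTestFunction (frameMap Γ E '' (Set.univ ×ˢ ω)) u) {p : ℝ} (hp : 0 < p) {s b c X : ℝ}
    (hc : 0 ≤ c) (hX : 0 ≤ X)
    (hjac : ∀ t ∈ ω, |frameJac Γ E s t - 1| ≤ b) (hcX : c * (1 + b) ≤ X * (1 - b))
    (hsec : ENNReal.ofReal X * ∫⁻ t, ‖ω.indicator (fun t => u (frameMap Γ E (s, t))) t‖ₑ ^ p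
      ≤ ∫⁻ t, ‖fderiv ℝ (ω.indicator fun t => u (frameMap Γ E (s, t))) t‖ₑ ^ p) :
    ENNReal.ofReal c *
        ∫⁻ t in ω, ENNReal.ofReal |frameJac Γ E s t| * ‖u (frameMap Γ E (s, t))‖ₑ ^ p
      ≤ ∫⁻ t in ω, ENNReal.ofReal |frameJac Γ E s t| * ‖fderiv ℝ u (frameMap Γ E (s, t))‖ₑ ^ p := by
  have hw := h.isTestFunction_slice hω ha hκ hinj hu s
  have hwω := hw.mono (Set.sep_subset ω _)
  set w := ω.indicator fun t => u (frameMap Γ E (s, t)) with hw_def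
  calc _ ≤ ENNReal.ofReal c * ∫⁻ t in ω, ENNReal.ofReal (1 + b) * ‖w t‖ₑ ^ p := by
        gcongr ENNReal.ofReal c * ?_
        refine setLIntegral_mono' hω.measurableSet fun t ht => ?_
        rw [hw_def, Set.indicator_of_mem ht]
        gcongr
        have := abs_le.1 (hjac t ht)
        rw [abs_le]
        constructor <;> linarith
    _ = ENNReal.ofReal (c * (1 + b)) * ∫⁻ t, ‖w t‖ₑ ^ p := by
        rw [lintegral_const_mul' _ _ ENNReal.ofReal_ne_top, ← mul_assoc, ← ENNReal.ofReal_mul hc,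
          hwω.setLIntegral_enorm hp]
    _ ≤ ENNReal.ofReal (X * (1 - b)) * ∫⁻ t, ‖w t‖ₑ ^ p := by gcongr
    _ = ENNReal.ofReal (1 - b) * (ENNReal.ofReal X * ∫⁻ t, ‖w t‖ₑ ^ p) := by
        rw [ENNReal.ofReal_mul hX]; ring
    _ ≤ ENNReal.ofReal (1 - b) * ∫⁻ t, ‖fderiv ℝ w t‖ₑ ^ p := by gcongr
    _ = ∫⁻ t in ω, ENNReal.ofReal (1 - b) * ‖fderiv ℝ w t‖ₑ ^ p := by
        rw [lintegral_const_mul' _ _ ENNReal.ofReal_ne_top, ← hwω.setLIntegral_enorm_gradient hp]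
        simp_rw [enorm_gradient]
    _ ≤ _ := by
        refine setLIntegral_mono' hω.measurableSet fun t ht => ?_
        have h1 := h.norm_fderiv_slice_le hω hu.differentiable s ht
        have h2 := abs_le.1 (hjac t ht)
        rw [← ofReal_norm, ← ofReal_norm]
        gcongr
        rw [le_abs]
        left; linarith

/-- In an asymptotically unbent tube the spectral threshold of the cross-section is a lower bound.
The compact set which is removed cuts a long piece of the tube down to a thin boundary layer, in
which the sections of test functions have large Rayleigh quotients. -/
theorem le_essSpectralThreshold (h : IsAdaptedFrame Γ E κ) (hn : 1 ≤ n) (hω : IsOpen ω)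
    (ha : ∀ t ∈ ω, ‖t‖ ≤ a) (ha0 : 0 ≤ a) (hκ : κ * a < 1)
    (hinj : Set.InjOn (frameMap Γ E) (Set.univ ×ˢ ω)) {p : ℝ} (hp : 1 < p)
    (hcurv : Tendsto (curvature Γ) (cocompact ℝ ⊓ ae volume) (𝓝 0)) :
    spectralThreshold p ω ≤ essSpectralThreshold p (frameMap Γ E '' (Set.univ ×ˢ ω)) := by
  have hp0 : 0 < p := by linarith
  refine le_of_forall_lt fun c₀ hc₀ => ?_
  obtain ⟨c₁, hc₁, hc₁'⟩ := exists_between hc₀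
  obtain ⟨c₂, hc₂, hc₂'⟩ := exists_between hc₁'
  lift c₁ to ℝ≥0 using hc₂.ne_top
  lift c₂ to ℝ≥0 using hc₂'.ne_top
  have hcc : (c₁ : ℝ) < c₂ := by exact_mod_cast hc₂
  refine hc₁.trans_le ?_
  set b := κ * a with hb
  have hb0 : 0 ≤ b := by positivity
  -- In the bent part the Jacobian lies in `[1 - b, 1 + b]`: a Rayleigh quotient `M` of the sections
  -- yields the quotient `c₁` on the tube.
  set M : ℝ≥0 := ⟨c₁ * (1 + b) / (1 - b), div_nonneg (by positivity) (by linarith)⟩ with hM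
  obtain ⟨δ, hδ0, hδ⟩ := exists_measure_le_imp_mul_lintegral_le hn hp M
  have hωfin : volume ω ≠ ∞ :=
    (measure_lt_top_of_subset (fun t ht => mem_closedBall_zero_iff.2 (ha t ht))
      measure_closedBall_lt_top.ne).ne
  obtain ⟨C, hCω, hC, hCδ⟩ := hω.measurableSet.exists_isCompact_sdiff_lt hωfin hδ0.ne'
  -- Where `κ ≤ ε`, the gap between `c₁` and `c₂` absorbs the Jacobian.
  obtain ⟨ε, hε0, hε⟩ : ∃ ε > 0, c₁ * (1 + a * ε) ≤ c₂ * (1 - a * ε) := by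
    have h1 : Tendsto (fun ε : ℝ => a * ε) (𝓝[>] 0) (𝓝 (a * 0)) :=
      (tendsto_id.const_mul a).mono_left nhdsWithin_le_nhds
    have h2 : Tendsto (fun ε : ℝ => c₂ * (1 - a * ε) - c₁ * (1 + a * ε)) (𝓝[>] 0)
        (𝓝 (c₂ * (1 - a * 0) - c₁ * (1 + a * 0))) :=
      ((h1.const_sub 1).const_mul _).sub ((h1.const_add 1).const_mul _)
    rw [mul_zero] at h2
    obtain ⟨ε, e1, e2⟩ := ((h2.eventually (lt_mem_nhds (a := 0) (by linarith))).and
      self_mem_nhdsWithin).exists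
    exact ⟨ε, e2, by linarith⟩
  obtain ⟨s₁, hs₁⟩ : ∃ s₁ : ℝ, ∀ᵐ s, s₁ < |s| → curvature Γ s < ε := by
    have h1 := hcurv.eventually (gt_mem_nhds hε0)
    obtain ⟨A, hA, B, hB, hAB⟩ := eventually_inf.1 h1 |>.imp fun _ h => h
    obtain ⟨K, hK, hKA⟩ := mem_cocompact.1 hA
    obtain ⟨r, hr⟩ := hK.isBounded.subset_closedBall 0
    refine ⟨r, ?_⟩
    filter_upwards [hB] with s hs hrs
    refine hAB s ⟨hKA fun hsK => ?_, hs⟩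
    have := hr hsK
    rw [mem_closedBall_zero_iff, Real.norm_eq_abs] at this
    linarith
  set K := frameMap Γ E '' (Set.Icc (-s₁) s₁ ×ˢ C) with hK
  have hKc : IsCompact K := (isCompact_Icc.prod hC).image h.continuous_frameMap
  have hKΩ : K ⊆ frameMap Γ E '' (Set.univ ×ˢ ω) :=
    Set.image_mono (Set.prod_mono (Set.subset_univ _) hCω)
  refine le_trans ?_ (le_iSup_of_le K (le_iSup_of_le hKc (le_iSup_of_le hKΩ le_rfl)))
  refine le_spectralThreshold hp.le ENNReal.coe_ne_top fun u hu => ?_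
  have huΩ := hu.mono Set.sdiff_subset
  rw [← huΩ.setLIntegral_enorm hp0, ← huΩ.setLIntegral_enorm_gradient hp0]
  simp_rw [enorm_gradient]
  rw [h.lintegral_image_frameMap hω.measurableSet hinj
      (hu.smooth.continuous.enorm.measurable.pow_const p),
    h.lintegral_image_frameMap hω.measurableSet hinj
      (hu.continuous_fderiv.enorm.measurable.pow_const p),
    ← lintegral_const_mul' _ _ ENNReal.coe_ne_top]
  refine lintegral_mono_ae ?_
  filter_upwards [hs₁] with s hs
  have hjac : ∀ t ∈ ω, |frameJac Γ E s t - 1| ≤ a * curvature Γ s := fun t ht =>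
    (h.abs_frameJac_sub_one_le s t).trans
      (mul_le_mul_of_nonneg_right (ha t ht) (norm_nonneg _))
  rw [← ENNReal.ofReal_coe_nnreal]
  have hw := h.isTestFunction_slice hω ha hκ hinj huΩ s
  rcases lt_or_ge s₁ |s| with hs' | hs'
  · refine h.slice_lower_bound hω ha hκ hinj huΩ hp0 c₁.coe_nonneg c₂.coe_nonneg (fun t ht => ?_) hε ?_
    · exact (hjac t ht).trans (mul_le_mul_of_nonneg_left (hs hs').le ha0)
    · refine le_trans ?_ ((hw.mono (Set.sep_subset ω _)).spectralThreshold_mul_le hp0)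
      rw [ENNReal.ofReal_coe_nnreal]
      gcongr
  · refine h.slice_lower_bound (X := M) (b := b) hω ha hκ hinj huΩ hp0 c₁.coe_nonneg M.coe_nonneg
      (fun t ht => ?_) ?_ ?_
    · rw [hb, mul_comm (κ : ℝ)]
      exact (hjac t ht).trans (mul_le_mul_of_nonneg_left (h.curvature_le s) ha0)
    · change _ ≤ c₁ * (1 + b) / (1 - b) * (1 - b)
      rw [div_mul_cancel₀ _ (by linarith)]
    · rw [ENNReal.ofReal_coe_nnreal]
      refine hδ _ (hw.smooth.of_le (by exact_mod_cast le_top)) hw.compact (ω \ C) hCδ.le ?_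
      refine (subset_tsupport _).trans (hw.support_subset.trans ?_)
      rintro t ⟨ht, htu⟩
      refine ⟨ht, fun htC => ?_⟩
      exact (hu.support_subset htu).2 ⟨(s, t), ⟨abs_le.1 hs', htC⟩, rfl⟩

end IsAdaptedFrame

/-! ### Product trial functions -/

open scoped NNReal in
theorem _root_.LocallyLipschitz.exists_lipschitzWith_of_hasCompactSupport {V : Type*}
    [NormedAddCommGroup V] [ProperSpace V] {v : V → ℝ} (hv : LocallyLipschitz v)
    (hc : HasCompactSupport v) : ∃ C : ℝ≥0, LipschitzWith C v := by
  obtain ⟨r, hr⟩ := hc.isCompact.isBounded.subset_closedBall 0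
  obtain ⟨C, hC⟩ := hv.locallyLipschitzOn.exists_lipschitzOnWith_of_compact
    (isCompact_closedBall (0 : V) (r + 1))
  obtain ⟨M, hM⟩ := hc.exists_bound_of_continuous hv.continuous
  have hM0 : 0 ≤ M := (norm_nonneg _).trans (hM 0)
  have hout : ∀ x, r < ‖x‖ → v x = 0 := fun x hx => image_eq_zero_of_notMem_tsupport fun h => by
    have := mem_closedBall_zero_iff.1 (hr h)
    linarith
  have key : ∀ x y, r + 1 < ‖x‖ → dist (v x) (v y) ≤ M * dist x y := by
    intro x y hx
    rw [hout x (by linarith), dist_zero_left]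
    rcases lt_or_ge r ‖y‖ with hy | hy
    · rw [hout y hy, norm_zero]; positivity
    · have h1 : 1 ≤ dist x y := by
        rw [dist_eq_norm]
        linarith [norm_sub_norm_le x y]
      nlinarith [hM y]
  refine ⟨C + ⟨M, hM0⟩, LipschitzWith.of_dist_le_mul fun x y => ?_⟩
  have hCM : ((C + ⟨M, hM0⟩ : ℝ≥0) : ℝ) = C + M := rfl
  have h1 : 0 ≤ C * dist x y := by positivity
  have h2 : 0 ≤ M * dist x y := by positivity
  rw [hCM, add_mul]
  rcases lt_or_ge (r + 1) ‖x‖ with hx | hx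
  · linarith [key x y hx]
  rcases lt_or_ge (r + 1) ‖y‖ with hy | hy
  · have := key y x hy
    rw [dist_comm, dist_comm y x] at this
    linarith
  · have := hC.dist_le_mul x (mem_closedBall_zero_iff.2 hx) y (mem_closedBall_zero_iff.2 hy)
    linarith

namespace IsAdaptedFrame

open scoped NNReal

variable {n : ℕ} {Γ : ℝ → Sp (n + 1)} {E : Fin n → ℝ → Sp (n + 1)} {κ : ℝ≥0}
  {ω : Set (Sp n)} {a : ℝ}

/-- The function `ρ(s) ψ(t)`, transplanted to the tube, is Lipschitz with compact support. -/
theorem exists_trial (h : IsAdaptedFrame Γ E κ) (hω : IsOpen ω)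
    (ha : ∀ t ∈ ω, ‖t‖ ≤ a) (hκ : κ * a < 1)
    (hinj : Set.InjOn (frameMap Γ E) (Set.univ ×ˢ ω)) {ρ : ℝ → ℝ} {τ : ℝ≥0}
    (hρ : LipschitzWith τ ρ) {I : Set ℝ} (hI : IsCompact I) (hρI : Function.support ρ ⊆ I)
    {ψ : Sp n → ℝ} (hψ : IsTestFunction ω ψ) :
    ∃ (v : Sp (n + 1) → ℝ) (C : ℝ≥0), LipschitzWith C v ∧ HasCompactSupport v ∧
      tsupport v ⊆ frameMap Γ E '' (I ×ˢ tsupport ψ) ∧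
      ∀ z ∈ Set.univ ×ˢ ω, v (frameMap Γ E z) = ρ z.1 * ψ z.2 := by
  obtain ⟨G, hGl, hG1, hG2⟩ := h.exists_locallyLipschitzOn_inverse hω ha hκ hinj
  set Ω := frameMap Γ E '' (Set.univ ×ˢ ω) with hΩ
  have hΩo : IsOpen Ω := h.isOpen_image_frameMap hω ha hκ
  let v : Sp (n + 1) → ℝ := Ω.indicator fun x => ρ (G x).1 * ψ (G x).2
  set Q := frameMap Γ E '' (I ×ˢ tsupport ψ) with hQ
  have hQc : IsCompact Q := (hI.prod hψ.compact.isCompact).image h.continuous_frameMap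
  have hv0 : ∀ x ∉ Q, v x = 0 := by
    intro x hx
    by_cases hxΩ : x ∈ Ω
    · by_contra hne
      simp only [v, Set.indicator_of_mem hxΩ] at hne
      refine hx ⟨G x, ⟨hρI (left_ne_zero_of_mul hne), ?_⟩, (hG2 x hxΩ).2⟩
      exact subset_tsupport _ (right_ne_zero_of_mul hne)
    · exact Set.indicator_of_notMem hxΩ _
  have hsupp : tsupport v ⊆ Q :=
    closure_minimal (fun x hx => by_contra fun h' => hx (hv0 x h')) hQc.isClosed
  have hc : HasCompactSupport v := hQc.of_isClosed_subset (isClosed_tsupport _) hsupp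
  have hψl : LocallyLipschitz ψ := (hψ.smooth.of_le (by simp) : ContDiff ℝ 1 ψ).locallyLipschitz
  have hprod : LocallyLipschitz fun z : ℝ × Sp n => ρ z.1 * ψ z.2 :=
    (hρ.locallyLipschitz.comp LipschitzWith.prod_fst.locallyLipschitz).smul_fun
      (hψl.comp LipschitzWith.prod_snd.locallyLipschitz)
  have hvl : LocallyLipschitz v := by
    intro x
    by_cases hx : x ∈ Ω
    · obtain ⟨C, U, hU, hUC⟩ := hGl hx
      obtain ⟨C', U', hU', hUC'⟩ := hprod (G x)
      have hGx : ContinuousWithinAt G Ω x := hGl.continuousOn x hx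
      refine ⟨C' * C, U ∩ Ω ∩ G ⁻¹' U', ?_, ?_⟩
      · rw [hΩo.nhdsWithin_eq hx] at hU
        exact inter_mem (inter_mem hU (hΩo.mem_nhds hx))
          ((hGx.continuousAt (hΩo.mem_nhds hx)).preimage_mem_nhds hU')
      · have h1 : LipschitzOnWith (C' * C) ((fun z : ℝ × Sp n => ρ z.1 * ψ z.2) ∘ G)
            (U ∩ Ω ∩ G ⁻¹' U') :=
          hUC'.comp (hUC.mono fun y hy => hy.1.1) fun y hy => hy.2
        intro y hy y' hy'
        have e1 : v y = ((fun z : ℝ × Sp n => ρ z.1 * ψ z.2) ∘ G) y :=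
          Set.indicator_of_mem hy.1.2 _
        have e2 : v y' = ((fun z : ℝ × Sp n => ρ z.1 * ψ z.2) ∘ G) y' :=
          Set.indicator_of_mem hy'.1.2 _
        rw [e1, e2]
        exact h1 hy hy'
    · have hxQ : x ∉ Q := fun hxQ => hx
        (Set.image_mono (Set.prod_mono (Set.subset_univ _) hψ.support_subset) hxQ)
      refine ⟨0, Qᶜ, hQc.isClosed.isOpen_compl.mem_nhds hxQ, fun y hy y' hy' => ?_⟩
      rw [hv0 y hy, hv0 y' hy', edist_self]
      exact zero_le
  obtain ⟨C, hC⟩ := hvl.exists_lipschitzWith_of_hasCompactSupport hc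
  refine ⟨v, C, hC, hc, hsupp, fun z hz => ?_⟩
  have : v (frameMap Γ E z) = ρ (G (frameMap Γ E z)).1 * ψ (G (frameMap Γ E z)).2 :=
    Set.indicator_of_mem (Set.mem_image_of_mem _ hz) _
  rw [this, hG1 z hz]

/-- The gradient of a transplanted product: the normal components are those of `ρ ∇ψ`, the
tangential one is `h⁻¹ (ρ' ψ - ρ f_μ ∂_μ ψ)`. At points where `v` is not differentiable the
estimate holds because the derivative has the value zero there. -/
theorem norm_fderiv_trial_le (h : IsAdaptedFrame Γ E κ) (hω : IsOpen ω) {ρ : ℝ → ℝ} {τ : ℝ≥0}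
    (hρ : LipschitzWith τ ρ) {ψ : Sp n → ℝ} (hψ : IsTestFunction ω ψ)
    {v : Sp (n + 1) → ℝ} (hv : ∀ z ∈ Set.univ ×ˢ ω, v (frameMap Γ E z) = ρ z.1 * ψ z.2)
    {s : ℝ} (hs : s ∈ frameRegular Γ E) {t : Sp n} (ht : t ∈ ω) (hj : 0 < frameJac Γ E s t) :
    ‖fderiv ℝ v (frameMap Γ E (s, t))‖ ≤ |ρ s| * ‖gradient ψ t‖
      + (frameJac Γ E s t)⁻¹ * (τ * |ψ t| + |ρ s| * |∑ μ, frameTwist E μ s t * gradient ψ t μ|) := by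
  by_cases hd : DifferentiableAt ℝ v (frameMap Γ E (s, t))
  swap
  · rw [fderiv_zero_of_not_differentiableAt hd, norm_zero]
    positivity
  set D := fderiv ℝ v (frameMap Γ E (s, t)) with hD
  have hcomp : HasFDerivAt (fun z => v (frameMap Γ E z)) (D.comp (frameDeriv Γ E (s, t))) (s, t) :=
    hd.hasFDerivAt.comp (s, t) (h.hasFDerivAt_frameMap hs t)
  have hcomp' : HasFDerivAt (fun z : ℝ × Sp n => ρ z.1 * ψ z.2)
      (D.comp (frameDeriv Γ E (s, t))) (s, t) := by
    refine hcomp.congr_of_eventuallyEq ?_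
    have hU : Set.univ ×ˢ ω ∈ 𝓝 (s, t) := (isOpen_univ.prod hω).mem_nhds ⟨trivial, ht⟩
    filter_upwards [hU] with z hz using (hv z hz).symm
  have hnorm : ∀ y : Sp n, D (∑ μ, y μ • E μ s) = ρ s * fderiv ℝ ψ t y := by
    intro y
    have h1 : HasFDerivAt (fun t' : Sp n => ρ s * ψ t')
        ((D.comp (frameDeriv Γ E (s, t))).comp (ContinuousLinearMap.inr ℝ ℝ (Sp n))) t :=
      HasFDerivAt.comp (f := fun t' : Sp n => (s, t')) t hcomp' (hasFDerivAt_prodMk_right s t)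
    have h2 := h1.unique ((hψ.differentiable t).hasFDerivAt.const_mul (ρ s))
    have h3 := congrArg (fun A : Sp n →L[ℝ] ℝ => A y) h2
    simpa [frameDeriv_apply] using h3
  have htan : |D (deriv Γ s + ∑ μ, t μ • deriv (E μ) s)| ≤ τ * |ψ t| := by
    have h1 : HasFDerivAt (fun s' : ℝ => ρ s' * ψ t)
        ((D.comp (frameDeriv Γ E (s, t))).comp (ContinuousLinearMap.inl ℝ ℝ (Sp n))) s :=
      HasFDerivAt.comp (f := fun s' : ℝ => (s', t)) s hcomp' (hasFDerivAt_prodMk_left s t)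
    have h2 : LipschitzWith (τ * ‖ψ t‖₊) fun s' : ℝ => ρ s' * ψ t := by
      refine LipschitzWith.of_dist_le_mul fun x y => ?_
      have := hρ.dist_le_mul x y
      rw [Real.dist_eq] at this
      rw [Real.dist_eq, ← sub_mul, abs_mul, NNReal.coe_mul, coe_nnnorm, Real.norm_eq_abs]
      nlinarith [abs_nonneg (ψ t)]
    have h3 := norm_deriv_le_of_lipschitz (x₀ := s) h2
    rw [h1.hasDerivAt.deriv] at h3
    simpa [frameDeriv_apply] using h3
  have hT : |D (deriv Γ s)| ≤ (frameJac Γ E s t)⁻¹ *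
      (τ * |ψ t| + |ρ s| * |∑ μ, frameTwist E μ s t * gradient ψ t μ|) := by
    rw [h.deriv_add_sum_eq hs] at htan
    have e1 := hnorm (WithLp.toLp 2 fun μ => frameTwist E μ s t)
    have e2 : fderiv ℝ ψ t (WithLp.toLp 2 fun μ => frameTwist E μ s t)
        = ∑ μ, frameTwist E μ s t * gradient ψ t μ := by
      rw [← InnerProductSpace.toDual_symm_apply (𝕜 := ℝ), PiLp.inner_apply]
      rfl
    rw [e2] at e1
    simp only at e1
    rw [map_add, map_smul, e1, smul_eq_mul] at htan
    rw [← div_eq_inv_mul, le_div_iff₀ hj, ← abs_of_pos hj, ← abs_mul, ← abs_mul]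
    have e3 := abs_sub_abs_le_abs_sub (frameJac Γ E s t * D (deriv Γ s))
      (-(ρ s * ∑ μ, frameTwist E μ s t * gradient ψ t μ))
    rw [sub_neg_eq_add, abs_neg] at e3
    rw [mul_comm (D _)]
    linarith
  refine ContinuousLinearMap.opNorm_le_bound _ (by positivity) fun x => ?_
  have hx := h.expand s x
  have hy := hnorm (WithLp.toLp 2 fun μ => ⟪E μ s, x⟫)
  simp only at hy
  have hyx : ‖(WithLp.toLp 2 fun μ => ⟪E μ s, x⟫ : Sp n)‖ ≤ ‖x‖ := by
    have e1 : ∑ μ, ⟪E μ s, x⟫ ^ 2 ≤ ‖x‖ ^ 2 := by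
      have := (h.orthonormal s).sum_inner_products_le (x := x) (s := Finset.univ)
      simpa using this
    refine (sq_le_sq₀ (norm_nonneg _) (norm_nonneg _)).1 ?_
    rw [EuclideanSpace.real_norm_sq_eq]
    exact e1
  have hTx : |⟪deriv Γ s, x⟫| ≤ ‖x‖ := by
    have := abs_real_inner_le_norm (deriv Γ s) x
    rwa [h.unit_speed, one_mul] at this
  rw [Real.norm_eq_abs, hx, map_add, map_smul, hy, ← hx, smul_eq_mul, add_mul, add_comm]
  refine (abs_add_le _ _).trans (add_le_add ?_ ?_)
  · rw [abs_mul, mul_assoc]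
    gcongr
    rw [norm_gradient]
    exact ((fderiv ℝ ψ t).le_opNorm _).trans (by gcongr)
  · rw [abs_mul, mul_comm]
    exact mul_le_mul hT hTx (abs_nonneg _) ((abs_nonneg _).trans hT)

theorem abs_sum_frameTwist_mul_le (h : IsAdaptedFrame Γ E κ) {s : ℝ} {ℓ : Fin n → ℝ}
    (hℓ : ∀ α, ‖deriv (E α) s‖ ≤ ℓ α) {t : Sp n} (ht : ‖t‖ ≤ a) (y : Sp n) :
    |∑ μ, frameTwist E μ s t * y μ| ≤ (a * ∑ α, ℓ α) * ‖y‖ := by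
  have h1 : ∑ μ, frameTwist E μ s t * y μ
      = ⟪∑ μ, y μ • E μ s, ∑ α, t α • deriv (E α) s⟫ := by
    simp only [sum_inner, inner_sum, real_inner_smul_left, real_inner_smul_right, frameTwist,
      Finset.sum_mul]
    rw [Finset.sum_comm]
    refine Finset.sum_congr rfl fun μ _ => Finset.sum_congr rfl fun α _ => by ring
  have h2 : ‖∑ α, t α • deriv (E α) s‖ ≤ a * ∑ α, ℓ α := by
    rw [Finset.mul_sum]
    refine norm_sum_le_of_le _ fun α _ => ?_
    rw [norm_smul]
    exact mul_le_mul ((PiLp.norm_apply_le t α).trans ht) (hℓ α) (norm_nonneg _)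
      ((norm_nonneg _).trans ht)
  rw [h1]
  refine (abs_real_inner_le_norm _ _).trans ?_
  rw [h.norm_sum_smul, mul_comm]
  gcongr

end IsAdaptedFrame

/-! ### The upper bound -/

/-- A trapezoidal cutoff, equal to one on `[c - M, c + M]`, with slopes `± τ`. -/
noncomputable def trapezoid (c M τ s : ℝ) : ℝ := max 0 (1 - τ * max 0 (|s - c| - M))

open scoped NNReal in
theorem lipschitzWith_trapezoid (c M : ℝ) (τ : ℝ≥0) : LipschitzWith τ (trapezoid c M τ) := by
  have h1 : LipschitzWith 1 fun s : ℝ => |s - c| - M :=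
    LipschitzWith.of_dist_le_mul fun x y => by
      rw [Real.dist_eq, Real.dist_eq, NNReal.coe_one, one_mul, sub_sub_sub_cancel_right]
      refine (abs_abs_sub_abs_le_abs_sub _ _).trans_eq ?_
      rw [sub_sub_sub_cancel_right]
  have h2 : LipschitzWith τ fun s : ℝ => 1 - τ * max 0 (|s - c| - M) :=
    LipschitzWith.of_dist_le_mul fun x y => by
      have := (h1.const_max 0).dist_le_mul x y
      rw [NNReal.coe_one, one_mul, dist_comm, Real.dist_eq] at this
      rw [Real.dist_eq, sub_sub_sub_cancel_left, ← mul_sub, abs_mul, abs_of_nonneg τ.coe_nonneg]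
      gcongr
  exact h2.const_max 0

theorem trapezoid_nonneg (c M τ s : ℝ) : 0 ≤ trapezoid c M τ s := le_max_left _ _

theorem trapezoid_le_one (c M : ℝ) {τ : ℝ} (hτ : 0 ≤ τ) (s : ℝ) : trapezoid c M τ s ≤ 1 := by
  have : 0 ≤ τ * max 0 (|s - c| - M) := mul_nonneg hτ (le_max_left _ _)
  exact max_le zero_le_one (by linarith)

theorem trapezoid_eq_one {c M s : ℝ} (τ : ℝ) (hs : s ∈ Set.Icc (c - M) (c + M)) :
    trapezoid c M τ s = 1 := by
  have : |s - c| ≤ M := abs_le.2 ⟨by linarith [hs.1], by linarith [hs.2]⟩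
  have h0 : max 0 (|s - c| - M) = 0 := max_eq_left (by linarith)
  rw [trapezoid, h0, mul_zero, sub_zero, max_eq_right zero_le_one]

theorem support_trapezoid_subset (c M : ℝ) {τ : ℝ} (hτ : 0 < τ) :
    Function.support (trapezoid c M τ) ⊆ Set.Icc (c - (M + τ⁻¹)) (c + (M + τ⁻¹)) := by
  intro s hs
  by_contra h
  refine hs (max_eq_left ?_)
  have h1 : M + τ⁻¹ < |s - c| := by
    by_contra h'
    rw [not_lt, abs_le] at h'
    exact h ⟨by linarith, by linarith⟩
  have h2 : τ⁻¹ ≤ max 0 (|s - c| - M) := le_max_of_le_right (by linarith)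
  have h3 : τ * τ⁻¹ ≤ τ * max 0 (|s - c| - M) := by gcongr
  rw [mul_inv_cancel₀ hτ.ne'] at h3
  linarith

/-- The analogue of `twistEnergy` in terms of the rotating frame. -/
noncomputable def frameEnergy {n : ℕ} (p : ℝ) (E : Fin n → ℝ → Sp (n + 1)) (ω : Set (Sp n))
    (g : Sp n → Sp n) (s : ℝ) : ℝ≥0∞ :=
  ∫⁻ t in ω, ‖∑ μ, frameTwist E μ s t * (g t) μ‖ₑ ^ p

namespace IsAdaptedFrame

open scoped NNReal

variable {n : ℕ} {Γ : ℝ → Sp (n + 1)} {E : Fin n → ℝ → Sp (n + 1)} {κ : ℝ≥0}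
  {ω : Set (Sp n)} {a : ℝ}

theorem continuous_frameTwist (E : Fin n → ℝ → Sp (n + 1)) (μ : Fin n) (s : ℝ) :
    Continuous fun t => frameTwist E μ s t := by
  unfold frameTwist
  fun_prop

/-- The gradient energy of a transplanted product on one cross-section of the tube. -/
theorem slice_upper_bound (h : IsAdaptedFrame Γ E κ) (hω : IsOpen ω)
    (ha : ∀ t ∈ ω, ‖t‖ ≤ a) {ρ : ℝ → ℝ} {τ : ℝ≥0} (hρ : LipschitzWith τ ρ)
    (hρ1 : ∀ s, |ρ s| ≤ 1) {ψ : Sp n → ℝ} (hψ : IsTestFunction ω ψ)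
    {v : Sp (n + 1) → ℝ} (hv : ∀ z ∈ Set.univ ×ˢ ω, v (frameMap Γ E z) = ρ z.1 * ψ z.2)
    {p : ℝ} (hp : 1 < p) {φ : Sp n → ℝ} {g : Sp n → Sp n} (hφ : MemW0 p ω φ g)
    {s : ℝ} (hs : s ∈ frameRegular Γ E) (hτ : τ ≤ 1 / 2)
    (hjac : ∀ t ∈ ω, |frameJac Γ E s t - 1| ≤ τ)
    {ℓ : Fin n → ℝ} (hℓ : ∀ α, ‖deriv (E α) s‖ ≤ ℓ α) {δ : ℝ≥0∞}
    (h1 : eLpNorm (fun x => φ x - ψ x) (ENNReal.ofReal p) (volume.restrict ω) < δ)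
    (h2 : eLpNorm (fun x => g x - gradient ψ x) (ENNReal.ofReal p) (volume.restrict ω) < δ) :
    ∫⁻ t in ω, ENNReal.ofReal |frameJac Γ E s t| * ‖fderiv ℝ v (frameMap Γ E (s, t))‖ₑ ^ p
      ≤ (1 + τ) * ((eLpNorm g (ENNReal.ofReal p) (volume.restrict ω) + δ)
        + (2 * (τ * (eLpNorm φ (ENNReal.ofReal p) (volume.restrict ω) + δ)
          + (frameEnergy p E ω g s ^ p⁻¹ + ENNReal.ofReal (a * ∑ α, ℓ α) * δ)))) ^ p := by
  have hp0 : 0 < p := by linarith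
  have hP : 1 ≤ ENNReal.ofReal p := by simpa using hp.le
  have hτ' : (τ : ℝ) ≤ 1 / 2 := by exact_mod_cast hτ
  set P := ENNReal.ofReal p with hPdef
  let F : Sp n → Sp n → ℝ := fun t y => ∑ μ, frameTwist E μ s t * y μ
  let q1 : Sp n → ℝ := fun t => ‖gradient ψ t‖
  let q2 : Sp n → ℝ := fun t => ‖ψ t‖
  let q3 : Sp n → ℝ := fun t => ‖F t (gradient ψ t)‖
  have hFc : Continuous fun t => F t (gradient ψ t) := by
    have := hψ.continuous_gradient
    have := fun μ => continuous_frameTwist E μ s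
    simp only [F]
    fun_prop
  have m1 : AEStronglyMeasurable q1 (volume.restrict ω) :=
    hψ.continuous_gradient.norm.aestronglyMeasurable
  have m2 : AEStronglyMeasurable q2 (volume.restrict ω) :=
    hψ.smooth.continuous.norm.aestronglyMeasurable
  have m3 : AEStronglyMeasurable q3 (volume.restrict ω) := hFc.norm.aestronglyMeasurable
  have hFm : ∀ {y : Sp n → Sp n}, AEStronglyMeasurable y (volume.restrict ω) →
      AEStronglyMeasurable (fun t => F t (y t)) (volume.restrict ω) := fun {y} hy => by
    refine Finset.aestronglyMeasurable_fun_sum _ fun μ _ => ?_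
    exact (continuous_frameTwist E μ s).aestronglyMeasurable.mul
      ((EuclideanSpace.proj (𝕜 := ℝ) μ).continuous.comp_aestronglyMeasurable hy)
  have mg := hφ.memW.memLp_grad.1
  have mψ := hψ.continuous_gradient.aestronglyMeasurable (μ := volume.restrict ω)
  have n1 : eLpNorm q1 P (volume.restrict ω) ≤ eLpNorm g P (volume.restrict ω) + δ := by
    rw [eLpNorm_norm]
    calc _ = eLpNorm (g - fun x => g x - gradient ψ x) P (volume.restrict ω) := by
          congr 1; ext x; simp
      _ ≤ _ := eLpNorm_sub_le mg (mg.sub mψ) hP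
      _ ≤ _ := by gcongr
  have n2 : eLpNorm q2 P (volume.restrict ω) ≤ eLpNorm φ P (volume.restrict ω) + δ := by
    have : eLpNorm q2 P (volume.restrict ω) = eLpNorm ψ P (volume.restrict ω) := eLpNorm_norm ψ
    rw [this]
    calc _ = eLpNorm (φ - fun x => φ x - ψ x) P (volume.restrict ω) := by
          congr 1; ext x; simp
      _ ≤ _ := eLpNorm_sub_le hφ.memW.memLp.1
        (hφ.memW.memLp.1.sub hψ.smooth.continuous.aestronglyMeasurable) hP
      _ ≤ _ := by gcongr
  have n3 : eLpNorm q3 P (volume.restrict ω)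
      ≤ frameEnergy p E ω g s ^ p⁻¹ + ENNReal.ofReal (a * ∑ α, ℓ α) * δ := by
    have e0 : eLpNorm q3 P (volume.restrict ω)
        = eLpNorm (fun t => F t (gradient ψ t)) P (volume.restrict ω) :=
      eLpNorm_norm fun t => F t (gradient ψ t)
    have e1 : (fun t => F t (gradient ψ t))
        = (fun t => F t (g t)) - fun t => F t (g t - gradient ψ t) := by
      ext t
      simp only [F, Pi.sub_apply, ← Finset.sum_sub_distrib, PiLp.sub_apply]
      exact Finset.sum_congr rfl fun μ _ => by ring
    have e2 : eLpNorm (fun t => F t (g t)) P (volume.restrict ω) = frameEnergy p E ω g s ^ p⁻¹ := by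
      rw [frameEnergy, ← eLpNorm_ofReal_rpow hp0, ENNReal.rpow_rpow_inv hp0.ne']
    have e3 : eLpNorm (fun t => F t (g t - gradient ψ t)) P (volume.restrict ω)
        ≤ ENNReal.ofReal (a * ∑ α, ℓ α) * δ := by
      refine (eLpNorm_le_mul_eLpNorm_of_ae_le_mul
        (g := fun t => g t - gradient ψ t) (c := a * ∑ α, ℓ α) ?_ P).trans (by gcongr)
      filter_upwards [ae_restrict_mem hω.measurableSet] with t ht
      exact h.abs_sum_frameTwist_mul_le hℓ (ha t ht) _
    rw [e0, e1]
    refine (eLpNorm_sub_le (hFm mg) (hFm (mg.sub mψ)) hP).trans ?_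
    rw [e2]
    exact add_le_add le_rfl e3
  let q : Sp n → ℝ := q1 + (2 : ℝ) • ((τ : ℝ) • q2 + q3)
  have nq : eLpNorm q P (volume.restrict ω)
      ≤ (eLpNorm g P (volume.restrict ω) + δ) + (2 * (τ * (eLpNorm φ P (volume.restrict ω) + δ)
          + (frameEnergy p E ω g s ^ p⁻¹ + ENNReal.ofReal (a * ∑ α, ℓ α) * δ))) := by
    refine (eLpNorm_add_le m1 (((m2.const_smul _).add m3).const_smul _) hP).trans ?_
    refine add_le_add n1 ?_
    rw [eLpNorm_const_smul]
    refine mul_le_mul' (by simp [← ofReal_norm]) ?_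
    refine (eLpNorm_add_le (m2.const_smul _) m3 hP).trans (add_le_add ?_ n3)
    rw [eLpNorm_const_smul]
    refine mul_le_mul' (by simp [← ofReal_norm]) n2
  calc _ ≤ ∫⁻ t in ω, (1 + τ) * ‖q t‖ₑ ^ p := by
        refine setLIntegral_mono' hω.measurableSet fun t ht => ?_
        have hj := abs_le.1 (hjac t ht)
        have hj0 : 1 / 2 ≤ frameJac Γ E s t := by linarith
        have hj1 : (frameJac Γ E s t)⁻¹ ≤ 2 := by
          rw [inv_le_comm₀ (by linarith) two_pos]
          linarith
        gcongr ?_ * ?_ ^ p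
        · rw [abs_of_nonneg (by linarith), ← ENNReal.ofReal_coe_nnreal, ← ENNReal.ofReal_one,
            ← ENNReal.ofReal_add zero_le_one τ.coe_nonneg]
          exact ENNReal.ofReal_le_ofReal (by linarith)
        · rw [← ofReal_norm, ← ofReal_norm]
          refine ENNReal.ofReal_le_ofReal ?_
          refine (h.norm_fderiv_trial_le hω hρ hψ hv hs ht (by linarith)).trans ?_
          refine le_trans ?_ (le_abs_self _)
          change _ ≤ q1 t + 2 * (τ * q2 t + q3 t)
          refine add_le_add (mul_le_of_le_one_left (norm_nonneg _) (hρ1 s)) ?_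
          gcongr
          · exact le_rfl
          · exact mul_le_of_le_one_left (abs_nonneg _) (hρ1 s)
    _ = (1 + τ) * eLpNorm q P (volume.restrict ω) ^ p := by
        rw [lintegral_const_mul' _ _ (by simp), hPdef, eLpNorm_ofReal_rpow hp0]
    _ ≤ _ := by gcongr

/-- The Rayleigh quotient of the transplanted function `ρ(s) ψ(t)`, where `ρ` is a long cutoff
with small slope far out in the tube and `ψ` is close to the first eigenfunction, is close to that
of the eigenfunction. -/
theorem spectralThreshold_diff_mul_le (h : IsAdaptedFrame Γ E κ) (hω : IsOpen ω)
    (ha : ∀ t ∈ ω, ‖t‖ ≤ a) (hκ : κ * a < 1)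
    (hinj : Set.InjOn (frameMap Γ E) (Set.univ ×ˢ ω)) {p : ℝ} (hp : 1 < p)
    {φ : Sp n → ℝ} {g : Sp n → Sp n} (hφ : IsFirstEigenfunction p ω φ g)
    (hcurv : Tendsto (curvature Γ) (atTop ⊓ ae volume) (𝓝 0))
    (htwist : Tendsto (frameEnergy p E ω g) (atTop ⊓ ae volume) (𝓝 0))
    {K : Set (Sp (n + 1))} (hK : IsCompact K) (hKΩ : K ⊆ frameMap Γ E '' (Set.univ ×ˢ ω))
    {τ : ℝ≥0} (hτ0 : 0 < τ) (hτ : τ ≤ 1 / 2) :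
    spectralThreshold p (frameMap Γ E '' (Set.univ ×ˢ ω) \ K) * ((1 - τ) * (1 - τ) ^ p)
      ≤ (1 + τ) * (1 + τ) * (spectralThreshold p ω ^ p⁻¹ + 9 * τ) ^ p := by
  have hp0 : 0 < p := by linarith
  have hτR : (0 : ℝ) < τ := hτ0
  have hτ' : (τ : ℝ) ≤ 1 / 2 := by exact_mod_cast hτ
  have hτne : (τ : ℝ≥0∞) ≠ 0 := by exact_mod_cast hτ0.ne'
  set P := ENNReal.ofReal p with hPdef
  have hP : 1 ≤ P := by simpa [hPdef] using hp.le
  obtain ⟨s₀, hs₀⟩ : ∃ s₀ : ℝ, ∀ z ∈ Set.univ ×ˢ ω, frameMap Γ E z ∈ K → z.1 < s₀ := by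
    obtain ⟨B, hB⟩ := ((h.isCompact_preimage hω ha hκ hinj hK hKΩ).image continuous_fst).bddAbove
    exact ⟨B + 1, fun z hz hzK => by linarith [hB ⟨z, ⟨hz, hzK⟩, rfl⟩]⟩
  obtain ⟨s₁, hs₁⟩ : ∃ s₁ : ℝ, ∀ᵐ s, s₁ ≤ s →
      a * curvature Γ s ≤ τ ∧ frameEnergy p E ω g s ^ p⁻¹ ≤ τ := by
    have e1 : ∀ᶠ s in atTop ⊓ ae volume, a * curvature Γ s < τ := by
      have := hcurv.const_mul a
      rw [mul_zero] at this
      exact this.eventually (gt_mem_nhds hτR)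
    have e2 : ∀ᶠ s in atTop ⊓ ae volume, frameEnergy p E ω g s ^ p⁻¹ < τ := by
      have := htwist.ennrpow_const p⁻¹
      rw [ENNReal.zero_rpow_of_pos (inv_pos.2 hp0)] at this
      exact this.eventually (gt_mem_nhds (pos_iff_ne_zero.2 hτne))
    obtain ⟨A, hA, B, hB, hAB⟩ := eventually_inf.1 (e1.and e2)
    obtain ⟨s₁, hs₁⟩ := mem_atTop_sets.1 hA
    refine ⟨s₁, ?_⟩
    filter_upwards [hB] with s hs hs'
    exact ⟨(hAB s ⟨hs₁ s hs', hs⟩).1.le, (hAB s ⟨hs₁ s hs', hs⟩).2.le⟩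
  -- The cutoff has slope `τ` on two ramps of width `τ⁻¹`; the plateau of half-length `τ⁻²` makes the
  -- ramps negligible.
  set M : ℝ := (τ : ℝ)⁻¹ ^ 2 with hM
  have hM0 : 0 < M := by positivity
  have hMτ : M + (τ : ℝ)⁻¹ = M * (1 + τ) := by rw [hM]; field_simp
  set c : ℝ := max s₀ s₁ + (M + (τ : ℝ)⁻¹) with hc
  set I := Set.Icc (c - (M + (τ : ℝ)⁻¹)) (c + (M + (τ : ℝ)⁻¹)) with hI
  have hIs : ∀ s ∈ I, s₀ ≤ s ∧ s₁ ≤ s := fun s hs => by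
    have h1 : max s₀ s₁ ≤ s := by linarith [hs.1]
    exact ⟨(le_max_left _ _).trans h1, (le_max_right _ _).trans h1⟩
  have hℓ : ∀ α, ∃ ℓ : ℝ≥0, ∀ s ∈ I, ‖deriv (E α) s‖ ≤ ℓ := fun α => by
    obtain ⟨ℓ, hℓ⟩ := (h.locallyLipschitz α).locallyLipschitzOn.exists_lipschitzOnWith_of_compact
      (isCompact_Icc (a := c - (M + (τ : ℝ)⁻¹) - 1) (b := c + (M + (τ : ℝ)⁻¹) + 1))
    refine ⟨ℓ, fun s hs => norm_deriv_le_of_lipschitzOn (Icc_mem_nhds ?_ ?_) hℓ⟩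
    · linarith [hs.1]
    · linarith [hs.2]
  choose ℓ hℓ using hℓ
  set L := ENNReal.ofReal (a * ∑ α, (ℓ α : ℝ)) with hL
  obtain ⟨δ, hδ0, hδτ, hδL⟩ : ∃ δ : ℝ≥0∞, 0 < δ ∧ δ ≤ τ ∧ L * δ ≤ τ := by
    -- `L` bounds the twist coefficients on the support of the cutoff, so replacing the
    -- eigenfunction by a `δ`-close test function changes the `L^p` norm of the twist term by at most `τ`.
    refine ⟨τ / (1 + L), ENNReal.div_pos hτne (by simp [hL]), ?_, ?_⟩
    · exact ENNReal.div_le_of_le_mul (le_mul_of_one_le_right' le_self_add)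
    · rw [← mul_div_assoc]
      refine ENNReal.div_le_of_le_mul ?_
      rw [mul_comm]
      gcongr
      exact le_add_self
  obtain ⟨ψ, hψ, h1, h2⟩ := hφ.memW0.approx δ hδ0
  have hφ1 : eLpNorm φ P (volume.restrict ω) = 1 := by
    have := eLpNorm_ofReal_rpow hp0 φ (μ := volume.restrict ω)
    rw [hφ.normalised] at this
    rw [← ENNReal.rpow_rpow_inv hp0.ne' (eLpNorm φ P _), this, ENNReal.one_rpow]
  have hgΛ : eLpNorm g P (volume.restrict ω) = spectralThreshold p ω ^ p⁻¹ := by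
    rw [← hφ.minimiser, ← eLpNorm_ofReal_rpow hp0, ENNReal.rpow_rpow_inv hp0.ne']
  set ρ := trapezoid c M τ with hρdef
  have hρ : LipschitzWith τ ρ := lipschitzWith_trapezoid c M τ
  have hρ1 : ∀ s, |ρ s| ≤ 1 := fun s => by
    rw [abs_of_nonneg (trapezoid_nonneg _ _ _ _)]
    exact trapezoid_le_one c M hτR.le s
  have hρI : Function.support ρ ⊆ I := support_trapezoid_subset c M hτR
  obtain ⟨v, C, hvl, hvc, hvs, hv⟩ := h.exists_trial hω ha hκ hinj hρ isCompact_Icc hρI hψ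
  set Ω := frameMap Γ E '' (Set.univ ×ˢ ω) with hΩ
  have hvΩ : tsupport v ⊆ Ω := hvs.trans
    (Set.image_mono (Set.prod_mono (Set.subset_univ _) hψ.support_subset))
  have hvK : tsupport v ⊆ Ω \ K := fun x hx => by
    refine ⟨hvΩ hx, fun hxK => ?_⟩
    obtain ⟨z, hz, rfl⟩ := hvs hx
    have := hs₀ z ⟨trivial, hψ.support_subset hz.2⟩ hxK
    linarith [(hIs z.1 hz.1).1]
  have hΩo : IsOpen Ω := h.isOpen_image_frameMap hω ha hκ
  have hmain := spectralThreshold_mul_le_of_lipschitzWith hp0 (hΩo.sdiff hK.isClosed) hvl hvc hvK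
  have hjac : ∀ s, a * curvature Γ s ≤ τ → ∀ t ∈ ω, |frameJac Γ E s t - 1| ≤ τ :=
    fun s hs t ht => (h.abs_frameJac_sub_one_le s t).trans
      ((mul_le_mul_of_nonneg_right (ha t ht) (norm_nonneg _)).trans hs)
  have hvint : ∫⁻ x, ‖v x‖ₑ ^ p = ∫⁻ x in Ω, ‖v x‖ₑ ^ p := by
    refine (setLIntegral_eq_of_support_subset fun x hx => hvΩ (subset_tsupport _ ?_)).symm
    intro h0
    simp [h0, hp0] at hx
  have hdint : ∫⁻ x, ‖fderiv ℝ v x‖ₑ ^ p = ∫⁻ x in Ω, ‖fderiv ℝ v x‖ₑ ^ p := by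
    refine (setLIntegral_eq_of_support_subset fun x hx => ?_).symm
    by_contra h0
    have h3 : fderiv ℝ v x = 0 := fderiv_of_notMem_tsupport (𝕜 := ℝ) fun h' => h0 (hvΩ h')
    rw [Function.mem_support, h3, ← ofReal_norm, norm_zero, ENNReal.ofReal_zero,
      ENNReal.zero_rpow_of_pos hp0] at hx
    exact hx rfl
  have hlow : ENNReal.ofReal (2 * M) * ((1 - τ) * (1 - τ) ^ p) ≤ ∫⁻ x, ‖v x‖ₑ ^ p := by
    have hψ1 : 1 - τ ≤ eLpNorm ψ P (volume.restrict ω) := by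
      rw [tsub_le_iff_right, ← hφ1]
      calc _ = eLpNorm (ψ + fun x => φ x - ψ x) P (volume.restrict ω) := by
            congr 1; ext x; simp
        _ ≤ _ := eLpNorm_add_le hψ.smooth.continuous.aestronglyMeasurable
          (hφ.memW0.memW.memLp.1.sub hψ.smooth.continuous.aestronglyMeasurable) hP
        _ ≤ _ := by gcongr; exact h1.le.trans hδτ
    rw [hvint, h.lintegral_image_frameMap hω.measurableSet hinj
      (hvl.continuous.enorm.measurable.pow_const p)]
    calc _ = ∫⁻ s in Set.Icc (c - M) (c + M), (1 - τ : ℝ≥0∞) * (1 - τ) ^ p := by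
          rw [setLIntegral_const, Real.volume_Icc, mul_comm]
          congr 2; ring
      _ ≤ ∫⁻ s in Set.Icc (c - M) (c + M), ∫⁻ t in ω,
            ENNReal.ofReal |frameJac Γ E s t| * ‖v (frameMap Γ E (s, t))‖ₑ ^ p := by
          refine setLIntegral_mono_ae' measurableSet_Icc ?_
          filter_upwards [hs₁] with s hs hsI
          have hsI' : s ∈ I := ⟨by linarith [hsI.1, inv_pos.2 hτR],
            by linarith [hsI.2, inv_pos.2 hτR]⟩
          calc _ ≤ (1 - τ : ℝ≥0∞) * eLpNorm ψ P (volume.restrict ω) ^ p := by gcongr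
            _ = ∫⁻ t in ω, (1 - τ : ℝ≥0∞) * ‖ψ t‖ₑ ^ p := by
                rw [hPdef, eLpNorm_ofReal_rpow hp0, lintegral_const_mul' _ _ (by simp)]
            _ ≤ _ := by
                refine setLIntegral_mono' hω.measurableSet fun t ht => ?_
                rw [hv (s, t) ⟨trivial, ht⟩]
                simp only [hρdef, trapezoid_eq_one (τ : ℝ) hsI, one_mul]
                gcongr
                have := abs_le.1 (hjac s (hs (hIs s hsI').2).1 t ht)
                rw [← ENNReal.ofReal_coe_nnreal, ← ENNReal.ofReal_one,
                  ← ENNReal.ofReal_sub _ τ.coe_nonneg]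
                refine ENNReal.ofReal_le_ofReal ((le_abs_self _).trans' (by linarith))
      _ ≤ _ := setLIntegral_le_lintegral _ _
  have hup : ∫⁻ x, ‖fderiv ℝ v x‖ₑ ^ p ≤ ENNReal.ofReal (2 * M) *
      ((1 + τ) * (1 + τ) * (spectralThreshold p ω ^ p⁻¹ + 9 * τ) ^ p) := by
    rw [hdint, h.lintegral_image_frameMap hω.measurableSet hinj
      ((measurable_fderiv ℝ v).enorm.pow_const p)]
    have hout : ∀ s ∉ I, ∫⁻ t in ω,
        ENNReal.ofReal |frameJac Γ E s t| * ‖fderiv ℝ v (frameMap Γ E (s, t))‖ₑ ^ p = 0 := by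
      intro s hs
      rw [setLIntegral_congr_fun hω.measurableSet (g := fun _ => 0), lintegral_zero]
      intro t ht
      have h3 : frameMap Γ E (s, t) ∉ tsupport v := fun hmem => by
        obtain ⟨z, hz, hzz⟩ := hvs hmem
        have := hinj ⟨trivial, hψ.support_subset hz.2⟩ ⟨trivial, ht⟩ hzz
        rw [this] at hz
        exact hs hz.1
      have h4 : fderiv ℝ v (frameMap Γ E (s, t)) = 0 := fderiv_of_notMem_tsupport (𝕜 := ℝ) h3
      beta_reduce
      rw [h4, ← ofReal_norm, norm_zero, ENNReal.ofReal_zero, ENNReal.zero_rpow_of_pos hp0, mul_zero]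
    rw [← setLIntegral_eq_of_support_subset (s := I) fun s hs => by_contra fun h' => hs (hout s h')]
    calc _ ≤ ∫⁻ s in I, (1 + τ : ℝ≥0∞) * (spectralThreshold p ω ^ p⁻¹ + 9 * τ) ^ p := by
          refine setLIntegral_mono_ae' measurableSet_Icc ?_
          filter_upwards [hs₁, h.ae_mem_frameRegular] with s hs hsr hsI
          obtain ⟨e1, e2⟩ := hs (hIs s hsI).2
          refine (h.slice_upper_bound hω ha hρ hρ1 hψ hv hp hφ.memW0 hsr hτ (hjac s e1)
            (fun α => hℓ α s hsI) h1 h2).trans ?_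
          rw [hφ1, hgΛ, ← hL]
          gcongr (1 + (τ : ℝ≥0∞)) * ?_ ^ p
          have hτ2 : (τ : ℝ≥0∞) ≤ 1 := by
            exact_mod_cast hτ.trans (by norm_num [← NNReal.coe_le_coe])
          calc _ ≤ spectralThreshold p ω ^ p⁻¹ + τ + 2 * (τ * (1 + 1) + (τ + τ)) := by
                gcongr
                exact hδτ.trans hτ2
            _ = _ := by ring
      _ = _ := by
          rw [setLIntegral_const, Real.volume_Icc]
          have : c + (M + (τ : ℝ)⁻¹) - (c - (M + (τ : ℝ)⁻¹)) = 2 * M * (1 + τ) := by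
            linear_combination 2 * hMτ
          rw [this, ENNReal.ofReal_mul (by positivity), ENNReal.ofReal_add zero_le_one
            τ.coe_nonneg, ENNReal.ofReal_one, ENNReal.ofReal_coe_nnreal]
          ring
  have hM' : ENNReal.ofReal (2 * M) ≠ 0 := by simpa using hM0
  rw [← ENNReal.mul_le_mul_iff_right hM' ENNReal.ofReal_ne_top]
  refine le_trans (le_of_eq (by ring)) ((mul_le_mul_right hlow
    (spectralThreshold p (Ω \ K))).trans (hmain.trans hup))

/-- The eigenfunction enters only through approximating test functions, so the estimate is made with
an error `τ`, which is then sent to zero. -/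
theorem essSpectralThreshold_le (h : IsAdaptedFrame Γ E κ) (hω : IsOpen ω)
    (ha : ∀ t ∈ ω, ‖t‖ ≤ a) (hκ : κ * a < 1)
    (hinj : Set.InjOn (frameMap Γ E) (Set.univ ×ˢ ω)) {p : ℝ} (hp : 1 < p)
    {φ : Sp n → ℝ} {g : Sp n → Sp n} (hφ : IsFirstEigenfunction p ω φ g)
    (hcurv : Tendsto (curvature Γ) (atTop ⊓ ae volume) (𝓝 0))
    (htwist : Tendsto (frameEnergy p E ω g) (atTop ⊓ ae volume) (𝓝 0)) :
    essSpectralThreshold p (frameMap Γ E '' (Set.univ ×ˢ ω)) ≤ spectralThreshold p ω := by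
  have hp0 : 0 < p := by linarith
  refine iSup_le fun K => iSup_le fun hK => iSup_le fun hKΩ => ?_
  set X := spectralThreshold p (frameMap Γ E '' (Set.univ ×ˢ ω) \ K)
  have hτ : Tendsto (fun τ : ℝ≥0 => (τ : ℝ≥0∞)) (𝓝[>] 0) (𝓝 0) :=
    (ENNReal.tendsto_coe.2 tendsto_id).mono_left nhdsWithin_le_nhds
  have h1 : Tendsto (fun τ : ℝ≥0 => X * ((1 - (τ : ℝ≥0∞)) * (1 - (τ : ℝ≥0∞)) ^ p)) (𝓝[>] 0)
      (𝓝 (X * ((1 - 0) * (1 - 0) ^ p))) := by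
    have e1 := ENNReal.Tendsto.sub (tendsto_const_nhds (x := (1 : ℝ≥0∞))) hτ (.inl ENNReal.one_ne_top)
    refine ENNReal.Tendsto.const_mul (ENNReal.Tendsto.mul e1 (.inl (by simp))
      (e1.ennrpow_const p) (.inl (by simp))) (.inl (by simp))
  have h2 : Tendsto (fun τ : ℝ≥0 => (1 + (τ : ℝ≥0∞)) * (1 + (τ : ℝ≥0∞)) *
        (spectralThreshold p ω ^ p⁻¹ + 9 * (τ : ℝ≥0∞)) ^ p) (𝓝[>] 0)
      (𝓝 ((1 + 0) * (1 + 0) * (spectralThreshold p ω ^ p⁻¹ + 9 * 0) ^ p)) := by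
    have e1 := (tendsto_const_nhds (x := (1 : ℝ≥0∞))).add hτ
    refine ENNReal.Tendsto.mul (ENNReal.Tendsto.mul e1 (.inl (by simp)) e1 (.inl (by simp)))
      (.inl (by simp)) (Tendsto.ennrpow_const _ (tendsto_const_nhds.add
        (ENNReal.Tendsto.const_mul hτ (.inr (by simp))))) (.inr (by simp))
  simp only [tsub_zero, ENNReal.one_rpow, mul_one, add_zero, mul_zero, one_mul,
    ENNReal.rpow_inv_rpow hp0.ne'] at h1 h2
  refine le_of_tendsto_of_tendsto h1 h2 ?_
  have hhalf : ∀ᶠ τ : ℝ≥0 in 𝓝[>] 0, τ ≤ 1 / 2 :=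
    nhdsWithin_le_nhds (ge_mem_nhds (by positivity))
  filter_upwards [self_mem_nhdsWithin, hhalf] with τ hτ0 hτ1
  exact h.spectralThreshold_diff_mul_le hω ha hκ hinj hp hφ hcurv htwist hK hKΩ hτ0 hτ1

end IsAdaptedFrame

/-! ### The rotated frame -/

/-- The rotated normal fields `E_μ = R_{μν} N_ν`. -/
noncomputable def rotatedFrame {n : ℕ} (N : Fin n → ℝ → Sp (n + 1))
    (R : ℝ → Matrix (Fin n) (Fin n) ℝ) (μ : Fin n) (s : ℝ) : Sp (n + 1) :=
  ∑ ν, R s μ ν • N ν s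

section

open scoped NNReal

variable {n : ℕ} {Γ : ℝ → Sp (n + 1)} {N : Fin n → ℝ → Sp (n + 1)} {k : Fin n → ℝ → ℝ}
  {R : ℝ → Matrix (Fin n) (Fin n) ℝ}

theorem tubeMap_eq_frameMap : tubeMap Γ N R = frameMap Γ (rotatedFrame N R) := by
  funext x
  simp only [tubeMap, frameMap, rotatedFrame, Finset.smul_sum, smul_smul]

theorem IsRotationFamily.sum_mul (hR : IsRotationFamily R) (s : ℝ) (μ ν : Fin n) :
    ∑ β, R s μ β * R s ν β = if μ = ν then 1 else 0 := by
  have h1 : R s * star (R s) = 1 :=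
    (Matrix.mem_orthogonalGroup_iff (Fin n) ℝ).1
      (Matrix.mem_specialOrthogonalGroup_iff.1 (hR.mem_SO s)).1
  have h2 := congrFun (congrFun h1 μ) ν
  rw [Matrix.mul_apply, Matrix.one_apply] at h2
  simpa [Matrix.star_apply] using h2

theorem inner_rotatedFrame (hN : IsRelativelyParallelFrame Γ N k) (c : Fin n → ℝ) (s : ℝ)
    (μ : Fin n) : ⟪rotatedFrame N R μ s, ∑ β, c β • N β s⟫ = ∑ β, c β * R s μ β := by
  rw [rotatedFrame, (hN.orthonormal s).inner_sum]
  simp [mul_comm]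

theorem isAdaptedFrame_rotatedFrame (hΓ : IsUnitSpeedC11 Γ) (hN : IsRelativelyParallelFrame Γ N k)
    (hR : IsRotationFamily R) {κ : ℝ≥0} (hκ : ∀ᵐ s, curvature Γ s ≤ κ) :
    IsAdaptedFrame Γ (rotatedFrame N R) κ where
  differentiable := hΓ.differentiable
  lipschitz_deriv := hΓ.locallyLipschitz_deriv.lipschitzWith_of_ae_norm_deriv_le hκ
  unit_speed := hΓ.unit_speed
  orthonormal s := by
    rw [orthonormal_iff_ite]
    intro μ ν
    have h1 := inner_rotatedFrame (R := R) hN (fun β => R s ν β) s μ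
    have h2 := hR.sum_mul s ν μ
    rw [rotatedFrame, rotatedFrame] at *
    rw [h1, h2]
    simp [eq_comm]
  normal μ s := by
    rw [rotatedFrame, inner_sum]
    exact Finset.sum_eq_zero fun ν _ => by rw [real_inner_smul_right, hN.normal, mul_zero]
  locallyLipschitz μ := LocallyLipschitz.sum_fun _ fun ν =>
    (hR.locallyLipschitz μ ν).smul_fun (hN.locallyLipschitz ν)

/-- Since the fields `N_ν` are relatively parallel, only the rotation `R` contributes to the twist
of the rotated frame. -/
theorem ae_frameTwist_rotatedFrame (hN : IsRelativelyParallelFrame Γ N k)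
    (hR : IsRotationFamily R) :
    ∀ᵐ s, ∀ (μ : Fin n) (t : Sp n), frameTwist (rotatedFrame N R) μ s t = twistCoeff R μ s t := by
  have h1 := ae_all_iff.2 hN.normal_deriv
  have h2 := ae_all_iff.2 fun μ => ae_all_iff.2 fun ν =>
    (hR.locallyLipschitz μ ν).ae_differentiableAt_real
  filter_upwards [h1, h2] with s hs1 hs2 μ t
  have hd : ∀ α, deriv (rotatedFrame N R α) s
      = (∑ β, deriv (fun s' => R s' α β) s • N β s) - (∑ β, R s α β * k β s) • deriv Γ s := by
    intro α
    have e1 : HasDerivAt (fun s' => ∑ β, R s' α β • N β s')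
        (∑ β, (R s α β • (-(k β s • deriv Γ s)) + deriv (fun s' => R s' α β) s • N β s)) s :=
      HasDerivAt.fun_sum fun β _ => (hs2 α β).hasDerivAt.smul (hs1 β)
    have e2 : deriv (rotatedFrame N R α) s = _ := e1.deriv
    rw [e2, Finset.sum_add_distrib, Finset.sum_smul]
    simp only [smul_neg, smul_smul, Finset.sum_neg_distrib]
    abel
  have hT : ⟪rotatedFrame N R μ s, deriv Γ s⟫ = 0 := by
    rw [rotatedFrame, sum_inner]
    exact Finset.sum_eq_zero fun ν _ => by
      rw [real_inner_smul_left, real_inner_comm, hN.normal, mul_zero]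
  simp only [frameTwist, twistCoeff]
  refine Finset.sum_congr rfl fun α _ => ?_
  rw [hd α, inner_sub_right, real_inner_smul_right, hT, mul_zero, sub_zero,
    inner_rotatedFrame hN, Finset.mul_sum]
  exact Finset.sum_congr rfl fun β _ => by ring

theorem ae_frameEnergy_rotatedFrame (hN : IsRelativelyParallelFrame Γ N k)
    (hR : IsRotationFamily R) (p : ℝ) (ω : Set (Sp n)) (g : Sp n → Sp n) :
    twistEnergy p R ω g =ᵐ[volume] frameEnergy p (rotatedFrame N R) ω g := by
  filter_upwards [ae_frameTwist_rotatedFrame hN hR] with s hs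
  simp only [twistEnergy, frameEnergy, hs]

/-- The smallness of the curvature, in real terms. As `ω` contains a point other than the origin,
the curvature is essentially bounded. -/
theorem IsNonOverlapping.exists_bounds {ω : Set (Sp n)} (hΩ : IsNonOverlapping Γ N R ω)
    (hn : 1 ≤ n) (hω : IsOpen ω) (hne : ω.Nonempty) (hbdd : Bornology.IsBounded ω) :
    ∃ (κ : ℝ≥0) (a : ℝ), (∀ᵐ s, curvature Γ s ≤ κ) ∧ 0 ≤ a ∧ (∀ t ∈ ω, ‖t‖ ≤ a) ∧ κ * a < 1 := by
  set A := ⨆ t ∈ ω, ‖t‖ₑ with hA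
  have hAω : ∀ t ∈ ω, ‖t‖ₑ ≤ A := fun t ht => le_iSup₂ (f := fun t _ => ‖t‖ₑ) t ht
  have hAtop : A ≠ ∞ := by
    obtain ⟨r, hr⟩ := hbdd.subset_closedBall 0
    refine ne_top_of_le_ne_top (ENNReal.ofReal_ne_top (r := r)) (iSup₂_le fun t ht => ?_)
    rw [← ofReal_norm]
    exact ENNReal.ofReal_le_ofReal (mem_closedBall_zero_iff.1 (hr ht))
  have hA0 : A ≠ 0 := by
    intro h0
    have h1 : ω ⊆ {0} := fun t ht => by
      have := hAω t ht
      rw [h0] at this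
      simpa using this
    have : Nonempty (Fin n) := ⟨⟨0, hn⟩⟩
    have : Nontrivial (Sp n) := inferInstance
    obtain ⟨t, ht⟩ := hne
    have h2 : volume ω ≤ volume ({0} : Set (Sp n)) := measure_mono h1
    rw [measure_singleton] at h2
    exact (hω.measure_pos volume ⟨t, ht⟩).ne' (le_antisymm h2 zero_le)
  have hb := hΩ.curvature_bound
  have hκtop : eLpNorm (curvature Γ) ∞ volume ≠ ∞ := by
    intro h0
    rw [h0, ENNReal.mul_top hA0] at hb
    simp at hb
  refine ⟨(eLpNorm (curvature Γ) ∞ volume).toNNReal, A.toReal, ?_, ENNReal.toReal_nonneg, ?_, ?_⟩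
  · have := enorm_ae_le_eLpNormEssSup (curvature Γ) volume
    filter_upwards [this] with s hs
    rw [← eLpNorm_exponent_top] at hs
    have h1 := (ENNReal.toReal_le_toReal (by simp) hκtop).2 hs
    rw [toReal_enorm, Real.norm_eq_abs] at h1
    exact (le_abs_self _).trans h1
  · intro t ht
    have := (ENNReal.toReal_le_toReal (by simp) hAtop).2 (hAω t ht)
    rwa [toReal_enorm] at this
  · rw [ENNReal.coe_toNNReal_eq_toReal, ← ENNReal.toReal_mul, mul_comm]
    exact ENNReal.toReal_lt_of_lt_ofReal (by simpa using hb)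

end

end BentTube

theorem theorem1p1 (p : ℝ) (hp : 1 < p) (n : ℕ) (hn : 1 ≤ n)
    (ω : Set (BentTube.Sp n)) (hω_open : IsOpen ω) (hω_conn : IsConnected ω)
    (hω_bdd : Bornology.IsBounded ω)
    (Γ : ℝ → BentTube.Sp (n + 1)) (hΓ : BentTube.IsUnitSpeedC11 Γ)
    (N : Fin n → ℝ → BentTube.Sp (n + 1)) (k : Fin n → ℝ → ℝ)
    (hN : BentTube.IsRelativelyParallelFrame Γ N k)
    (R : ℝ → Matrix (Fin n) (Fin n) ℝ) (hR : BentTube.IsRotationFamily R)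
    (hΩ : BentTube.IsNonOverlapping Γ N R ω) :
    -- stability of the essential spectral threshold
    (∀ (φ : BentTube.Sp n → ℝ) (g : BentTube.Sp n → BentTube.Sp n),
      BentTube.IsFirstEigenfunction p ω φ g →
      Tendsto (BentTube.curvature Γ) (cocompact ℝ ⊓ ae volume) (𝓝 0) →
      Tendsto (BentTube.twistEnergy p R ω g) (cocompact ℝ ⊓ ae volume) (𝓝 0) →
      BentTube.essSpectralThreshold p (BentTube.tube Γ N R ω)
        = BentTube.spectralThreshold p ω) ∧
    -- the lower bound, for asymptotically unbent tubes
    (Tendsto (BentTube.curvature Γ) (cocompact ℝ ⊓ ae volume) (𝓝 0) →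
      BentTube.spectralThreshold p ω
        ≤ BentTube.essSpectralThreshold p (BentTube.tube Γ N R ω)) ∧
    -- the upper bound, with the decay at one end only
    (∀ (φ : BentTube.Sp n → ℝ) (g : BentTube.Sp n → BentTube.Sp n),
      BentTube.IsFirstEigenfunction p ω φ g →
      Tendsto (BentTube.curvature Γ) (atTop ⊓ ae volume) (𝓝 0) →
      Tendsto (BentTube.twistEnergy p R ω g) (atTop ⊓ ae volume) (𝓝 0) →
      BentTube.essSpectralThreshold p (BentTube.tube Γ N R ω)
        ≤ BentTube.spectralThreshold p ω) := by
  obtain ⟨κ, a, hκ, ha0, ha, hκa⟩ := hΩ.exists_bounds hn hω_open hω_conn.nonempty hω_bdd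
  have hE := BentTube.isAdaptedFrame_rotatedFrame hΓ hN hR hκ
  have hinj := hΩ.injOn
  rw [BentTube.tubeMap_eq_frameMap] at hinj
  have htube : BentTube.tube Γ N R ω
      = BentTube.frameMap Γ (BentTube.rotatedFrame N R) '' (Set.univ ×ˢ ω) := by
    rw [BentTube.tube, BentTube.tubeMap_eq_frameMap]
  rw [htube]
  have lower : Tendsto (BentTube.curvature Γ) (cocompact ℝ ⊓ ae volume) (𝓝 0) → _ :=
    hE.le_essSpectralThreshold hn hω_open ha ha0 hκa hinj hp
  have upper : ∀ (φ : BentTube.Sp n → ℝ) (g : BentTube.Sp n → BentTube.Sp n),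
      BentTube.IsFirstEigenfunction p ω φ g →
      Tendsto (BentTube.curvature Γ) (atTop ⊓ ae volume) (𝓝 0) →
      Tendsto (BentTube.twistEnergy p R ω g) (atTop ⊓ ae volume) (𝓝 0) → _ :=
    fun φ g hφ hc ht => hE.essSpectralThreshold_le hω_open ha hκa hinj hp hφ hc
      (ht.congr' ((BentTube.ae_frameEnergy_rotatedFrame hN hR p ω g).filter_mono inf_le_right))
  have hle : atTop ⊓ ae (volume : Measure ℝ) ≤ cocompact ℝ ⊓ ae volume :=
    inf_le_inf_right _ atTop_le_cocompact
  exact ⟨fun φ g hφ hc ht => le_antisymm (upper φ g hφ (hc.mono_left hle) (ht.mono_left hle))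
    (lower hc), lower, upper⟩
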